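/- Work over the max-plus semiring $\mathbb R_{\max}=\mathbb R\cup\{-\infty\}$ with $a\oplus b=\max(a,b)$, $a\otimes b=a+b$. Let $A=(a_{ij})\in\mathbb R_{\max}^{n\times n}$, and let $\mathcal D(A)$ be its digraph on the nodes $1,\dots,n$, with an arc $(i,j)$ of weight $a_{ij}$ whenever $a_{ij}\neq-\infty$. A walk is a nonempty sequence of nodes joined by consecutive arcs; its length is its number of nodes minus one, and its weight $p(W)$ is the sum of the weights of its arcs. Let $\lambda(A)$ be the maximum, over the cycles of $\mathcal D(A)$, of weight divided by length; a cycle attaining it is called critical. The critical graph $\mathcal C(A)$ consists of the nodes and arcs of the critical cycles; let $\gamma$ be its cyclicity (the least common multiple, over its strongly connected components, of the gcd of the cycle lengths in the component) and let $g$ be its maximal girth (the maximum, over its strongly connected components, of the least length of a cycle in the component). For $t\ge 0$ let $CS^tR$ be the product in which, with $M=\bigoplus_{k=0}^{n-1}(\lambda(A)^{-}\otimes A)^{\gamma k}$, the matrix $C$ (resp. $R$) is obtained from $M$ by replacing by $-\infty$ the columns (resp. rows) of the nodes that are not in $\mathcal C(A)$, and $S$ is obtained from $A$ by replacing by $-\infty$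 the entries that are not arcs of $\mathcal C(A)$. Let $B$ be obtained from $A$ by replacing by $-\infty$ all rows and columns of nodes of $\mathcal C(A)$, and let $T_1(A)$ be the least $T$ such that $A^t=CS^tR\oplus B^t$ for all $t\ge T$. Put $\mathrm{DM}(g,n)=g(n-2)+n$. Assume that $\lambda(A)=0$, that $g\ge 2$, that $T_1(A)=\mathrm{DM}(g,n)$, and that it is not the case that $n=g=2$. Then there is a critical cycle $Z_0$ of length $g$, and it is the only one up to the choice of its first node. Call a walk $W_0$ from $i$ to $j$ of length $t$ that goes through a node of $Z_0$ interesting if it has minimal length among the walks of maximal weight in the set of all walks from $i$ to $j$ that go through a node of $Z_0$ and have length congruent to $t$ modulo $g$, and if moreover $t=\mathrm{DM}(g,n)+g-1$. For every interesting walk $W_0$ there is a renumbering of the nodes such that $1,\dots,g$ are exactly the nodes of $Z_0$ and $$W_0=(g+1)\dots n\,(1\dots n)^g .$$ -/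

import Mathlib

noncomputable section

/-- The max-plus semiring `ℝ ∪ {-∞}`: `⊔` is the max-plus addition, `+` is the max-plus
multiplication, `⊥ = -∞` is the max-plus zero and `0` is the max-plus unity. -/
abbrev Rmax : Type := WithBot ℝ

/-- Square max-plus matrices. Plain functions are used, so that `A ⊔ B` is the max-plus sum and the
ordinary matrix product is not available by accident. -/
abbrev MPMat (n : ℕ) : Type := Fin n → Fin n → Rmax

namespace MaxPlus

/-! ### Matrix algebra -/

/-- The max-plus identity matrix. -/
def one (n : ℕ) : MPMat n := fun i j => if i = j then 0 else ⊥

/-- The max-plus matrix product. -/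
def mul {n : ℕ} (A B : MPMat n) : MPMat n :=
  fun i j => Finset.univ.sup fun k => A i k + B k j

/-- Max-plus matrix powers. -/
def pow {n : ℕ} (A : MPMat n) : ℕ → MPMat n
  | 0 => one n
  | t + 1 => mul (pow A t) A

/-- Multiplication of a matrix by a scalar. -/
def smul {n : ℕ} (c : Rmax) (A : MPMat n) : MPMat n := fun i j => c + A i j

/-- The Kleene star `I ⊕ A ⊕ ⋯ ⊕ A^(n-1)`. -/
def star {n : ℕ} (A : MPMat n) : MPMat n :=
  fun i j => (Finset.range n).sup fun k => pow A k i j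

/-- The multiplicative inverse `α⁻ = -α` of `α ≠ -∞` (with value `-∞` at `-∞`). -/
def inv (c : Rmax) : Rmax := c.map fun x => -x

/-! ### Digraphs on the nodes `Fin n`, given by their arc relation -/

/-- A walk, given by its nonempty sequence of nodes. -/
def IsWalk {n : ℕ} (E : Fin n → Fin n → Prop) (W : List (Fin n)) : Prop :=
  W ≠ [] ∧ W.IsChain E

/-- The length of a walk: its number of nodes minus one. -/
def len {n : ℕ} (W : List (Fin n)) : ℕ := W.length - 1

/-- A cycle `i₁ i₂ … i_k i₁` (`k ≥ 1`): a closed walk of positive length in which no node is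
repeated, except that the first node is also the last one. -/
def IsCycle {n : ℕ} (E : Fin n → Fin n → Prop) (Z : List (Fin n)) : Prop :=
  IsWalk E Z ∧ 1 ≤ len Z ∧ Z.head? = Z.getLast? ∧ Z.tail.Nodup

/-- Two cycles agree up to the choice of the first node. -/
def SameCycle {n : ℕ} (Z Z' : List (Fin n)) : Prop := Z.tail.IsRotated Z'.tail

/-- The nodes `i` and `j` are in the same strongly connected component. -/
def SameSCC {n : ℕ} (E : Fin n → Fin n → Prop) (i j : Fin n) : Prop :=
  Relation.ReflTransGen E i j ∧ Relation.ReflTransGen E j i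

/-- `l` is the length of a cycle of the strongly connected component of `i`. -/
def IsSCCCycleLength {n : ℕ} (E : Fin n → Fin n → Prop) (i : Fin n) (l : ℕ) : Prop :=
  ∃ Z, IsCycle E Z ∧ len Z = l ∧ ∃ v ∈ Z, SameSCC E i v

/-- The girth of the strongly connected component of `i`. -/
def sccGirth {n : ℕ} (E : Fin n → Fin n → Prop) (i : Fin n) : ℕ :=
  sInf {l | IsSCCCycleLength E i l}

open Classical in
/-- The cyclicity of the strongly connected component of `i`: the greatest common divisor of its
cycle lengths (all of which are at most `n`). -/
def sccCyclicity {n : ℕ} (E : Fin n → Fin n → Prop) (i : Fin n) : ℕ :=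
  ((Finset.Icc 1 n).filter fun l => IsSCCCycleLength E i l).gcd id

/-! ### Max-plus matrices as weighted digraphs -/

/-- The arcs of the digraph associated with `A`. -/
def Arc {n : ℕ} (A : MPMat n) (i j : Fin n) : Prop := A i j ≠ ⊥

/-- The weight of a walk. -/
def weight {n : ℕ} (A : MPMat n) (W : List (Fin n)) : Rmax :=
  ((W.zip W.tail).map fun p => A p.1 p.2).sum

/-- The mean weight of a cycle. -/
def cycleMean {n : ℕ} (A : MPMat n) (Z : List (Fin n)) : Rmax :=
  (weight A Z).map fun w => w / (len Z : ℝ)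

/-- The maximum cycle mean `λ(A)`; there are finitely many cycles, and `λ(A) = -∞` if there is
none. -/
def maxCycleMean {n : ℕ} (A : MPMat n) : Rmax :=
  sSup {x | ∃ Z, IsCycle (Arc A) Z ∧ cycleMean A Z = x}

/-- Critical cycles: those which attain the maximum cycle mean. -/
def IsCritCycle {n : ℕ} (A : MPMat n) (Z : List (Fin n)) : Prop :=
  IsCycle (Arc A) Z ∧ cycleMean A Z = maxCycleMean A

/-- The nodes of the critical graph. -/
def CritNode {n : ℕ} (A : MPMat n) (i : Fin n) : Prop := ∃ Z, IsCritCycle A Z ∧ i ∈ Z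

/-- The arcs of the critical graph. -/
def CritArc {n : ℕ} (A : MPMat n) (i j : Fin n) : Prop :=
  ∃ Z, IsCritCycle A Z ∧ [i, j] <:+: Z

open Classical in
/-- The maximal girth of the critical graph: the maximum of the girths of its strongly connected
components. -/
def critGirth {n : ℕ} (A : MPMat n) : ℕ :=
  (Finset.univ.filter fun i => CritNode A i).sup (sccGirth (CritArc A))

open Classical in
/-- The cyclicity of the critical graph: the least common multiple of the cyclicities of its
strongly connected components. -/
def critCyclicity {n : ℕ} (A : MPMat n) : ℕ :=
  (Finset.univ.filter fun i => CritNode A i).lcm (sccCyclicity (CritArc A))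

/-! ### The weak CSR expansion -/

/-- The matrix `M = ((λ(A)⁻ ⊗ A)^γ)^*`, where `γ` is the cyclicity of the critical graph. -/
def csrM {n : ℕ} (A : MPMat n) : MPMat n :=
  star (pow (smul (inv (maxCycleMean A)) A) (critCyclicity A))

open Classical in
/-- The matrix `C`. -/
def csrC {n : ℕ} (A : MPMat n) : MPMat n :=
  fun i j => if CritNode A j then csrM A i j else ⊥

open Classical in
/-- The matrix `R`. -/
def csrR {n : ℕ} (A : MPMat n) : MPMat n :=
  fun i j => if CritNode A i then csrM A i j else ⊥

open Classical in
/-- The matrix `S`. -/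
def csrS {n : ℕ} (A : MPMat n) : MPMat n :=
  fun i j => if CritArc A i j then A i j else ⊥

/-- The matrix `C S^t R`. If `λ(A) = -∞` there is no critical node, and all entries are `-∞`. -/
def csr {n : ℕ} (A : MPMat n) (t : ℕ) : MPMat n :=
  mul (mul (csrC A) (pow (csrS A) t)) (csrR A)

open Classical in
/-- The Nachtigall matrix of `A`. -/
def nacht {n : ℕ} (A : MPMat n) : MPMat n :=
  fun i j => if CritNode A i ∨ CritNode A j then ⊥ else A i j

/-- The weak CSR threshold `T₁(A)`: the least `T` with `A^t = C S^t R ⊕ B^t` for all `t ≥ T`, where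
`B` is the Nachtigall matrix. -/
def T1 {n : ℕ} (A : MPMat n) : ℕ :=
  sInf {T | ∀ t, T ≤ t → pow A t = csr A t ⊔ pow (nacht A) t}

/-- The Dulmage–Mendelsohn number `g (n - 2) + n`. -/
def DM (g n : ℕ) : ℤ := (g : ℤ) * ((n : ℤ) - 2) + (n : ℤ)

/-! ### Interesting walks -/

/-- The walks on the digraph of `A` from `i` to `j` which have length `t` modulo `γ` and go through
a node of `Z`. -/
def walksThrough {n : ℕ} (A : MPMat n) (i j : Fin n) (t γ : ℕ) (Z : List (Fin n)) :
    Set (List (Fin n)) :=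
  {V | IsWalk (Arc A) V ∧ V.head? = some i ∧ V.getLast? = some j ∧ len V ≡ t [MOD γ] ∧
    ∃ v ∈ V, v ∈ Z}

/-- `W`, from `i` to `j` and of length `t`, is twice optimal with respect to the critical cycle `Z`
of length `g`: it has minimal length among the walks of maximal weight in the set of walks from `i`
to `j` through a node of `Z` with length `t` modulo `g`. -/
def IsTwiceOptimal {n : ℕ} (A : MPMat n) (g : ℕ) (Z W : List (Fin n)) : Prop :=
  ∃ i j, W ∈ walksThrough A i j (len W) g Z ∧
    (∀ V ∈ walksThrough A i j (len W) g Z, weight A V ≤ weight A W) ∧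
    ∀ V ∈ walksThrough A i j (len W) g Z, weight A V = weight A W → len W ≤ len V

/-- Interesting walks: the twice optimal walks of length `DM(g,n) + g - 1`. -/
def IsInteresting {n : ℕ} (A : MPMat n) (g : ℕ) (Z W : List (Fin n)) : Prop :=
  IsTwiceOptimal A g Z W ∧ (len W : ℤ) = DM g n + g - 1

/-- The sequence of nodes `(g+1) … n (1 … n)^g`, where `σ k` is the node that receives the number
`k + 1` (`k = 0, …, n - 1`). -/
def flower {n : ℕ} (g : ℕ) (σ : Equiv.Perm (Fin n)) : List (Fin n) :=
  ((List.finRange n).drop g ++ (List.replicate g (List.finRange n)).flatten).map σ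

end MaxPlus

end

/-! Since `λ(A) = 0`, a potential `φ` writes every arc weight as `φ i - φ j - c i j` with `c ≥ 0`.
Between fixed ends a walk is heavy exactly when its cost is small, and the arcs of the critical
graph are free. Fix a free cycle `ζ` of length `g` and a walk through it that is shortest among
those through `ζ` with the same ends, the same length modulo `g` and at most the same cost
(`OptWalk`). Nothing can be cut from it: neither two loops on either side of a visit of `ζ` with
total length divisible by `g` (`OptWalk.excise`), nor a detour between two nodes of `ζ` that the
path along `ζ` replaces without changing the length modulo `g` (`OptWalk.sub_eq_val`). By pigeonhole
modulo `g`, nodes of `ζ` are visited at most `g` times and other nodes at most `g + 1` times, so the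
length is at most `DM(g,n) + g - 1`.

At this maximal length every bound is attained. The visits of `ζ` then form `g` full turns, and
counting visits fixes where they start, once in each period of `n` positions (`OptWalk.blocks`).
Exchanging two consecutive loops at a node preserves optimality, hence this pattern. Comparing both
walks shows that three visits of a node are congruent modulo `n`; a parity argument replaces the
missing third visit when `g = 2`. So the walk has period `n`, which is the flower
(`OptWalk.exists_perm`). The same exchange excludes a Hamiltonian `ζ` with `g ≥ 3`.

If `T₁(A) = DM(g,n)`, then for `t = DM(g,n) - 1` some entry of `CS^tR` exceeds that of `A^t`. It
comes from a walk through a critical node, hence from an optimal one. The latter is longer than `t`,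
since free turns would otherwise pad it to length `t`; being congruent to `t`, it has exactly the
maximal length, and its cycle has length `g` (`exists_extremal_walk`). A critical cycle of length
`g` with a node off `ζ` could be inserted `n - 1` times in the initial segment of this walk, giving
a walk of length `t` that is at least as heavy. So all such cycles live on the nodes of `ζ`, which
has no chord in the critical graph. -/

namespace MaxPlus

/-! ### Walks with costs -/

/-- `CostWalk E c i j l x`: there is a walk from `i` to `j` of length `l` and cost `x`. -/
inductive CostWalk {V : Type*} (E : V → V → Prop) (c : V → V → ℝ) : V → V → ℕ → ℝ → Prop
  | nil (i : V) : CostWalk E c i i 0 0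
  | snoc {i j k : V} {l : ℕ} {x : ℝ} :
      CostWalk E c i j l x → E j k → CostWalk E c i k (l + 1) (x + c j k)

theorem CostWalk.append {V : Type*} {E : V → V → Prop} {c : V → V → ℝ} {i j k : V} {l m : ℕ}
    {x y : ℝ} (h : CostWalk E c i j l x) (h' : CostWalk E c j k m y) :
    CostWalk E c i k (l + m) (x + y) := by
  induction h' with
  | nil => simpa using h
  | snoc _ hE ih =>
    rw [← add_assoc, ← add_assoc]
    exact ih.snoc hE

/-- The cost of the part of `w` between the positions `p` and `q`. -/
def walkCost {V : Type*} (c : V → V → ℝ) (w : ℕ → V) (p q : ℕ) : ℝ :=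
  ∑ k ∈ Finset.Ico p q, c (w k) (w (k + 1))

theorem walkCost_add {V : Type*} (c : V → V → ℝ) (w : ℕ → V) {p q r : ℕ} (hpq : p ≤ q)
    (hqr : q ≤ r) : walkCost c w p q + walkCost c w q r = walkCost c w p r :=
  Finset.sum_Ico_consecutive _ hpq hqr

theorem walkCost_nonneg {V : Type*} {c : V → V → ℝ} (hc : ∀ i j, 0 ≤ c i j) (w : ℕ → V)
    (p q : ℕ) : 0 ≤ walkCost c w p q :=
  Finset.sum_nonneg fun _ _ => hc _ _

theorem costWalk_segment {V : Type*} {E : V → V → Prop} {c : V → V → ℝ} {w : ℕ → V} {L : ℕ}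
    (hE : ∀ k < L, E (w k) (w (k + 1))) {p q : ℕ} (hpq : p ≤ q) (hq : q ≤ L) :
    CostWalk E c (w p) (w q) (q - p) (walkCost c w p q) := by
  induction q, hpq using Nat.le_induction with
  | base => simpa [walkCost] using CostWalk.nil (w p)
  | succ q hpq ih =>
    have h := (ih (by omega)).snoc (hE q (by omega))
    rw [walkCost, Finset.sum_Ico_succ_top hpq, Nat.sub_add_comm hpq]
    exact h

theorem CostWalk.exists_walk {V : Type*} {E : V → V → Prop} {c : V → V → ℝ} {i j : V} {l : ℕ}
    {x : ℝ} (h : CostWalk E c i j l x) :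
    ∃ w : ℕ → V, w 0 = i ∧ w l = j ∧ (∀ k < l, E (w k) (w (k + 1))) ∧ walkCost c w 0 l = x := by
  induction h with
  | nil => exact ⟨fun _ => i, rfl, rfl, by simp, by simp [walkCost]⟩
  | @snoc j k l x _ hE ih =>
    obtain ⟨w, h0, hl, hw, hx⟩ := ih
    have hlt : ∀ m ≤ l, Function.update w (l + 1) k m = w m := fun m hm =>
      Function.update_of_ne (by omega) _ _
    refine ⟨Function.update w (l + 1) k, by rw [hlt 0 (by omega), h0], by simp, ?_, ?_⟩
    · intro m hm
      rcases Nat.lt_succ_iff_lt_or_eq.mp hm with hm | rfl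
      · rw [hlt _ hm.le, hlt _ hm]; exact hw m hm
      · rw [hlt _ le_rfl, hl]; simpa using hE
    · rw [walkCost, Finset.sum_Ico_succ_top (Nat.zero_le l), hlt l le_rfl, hl, ← hx]
      simp only [Function.update_self]
      congr 1
      refine Finset.sum_congr rfl fun m hm => ?_
      have := (Finset.mem_Ico.mp hm).2
      rw [hlt _ this.le, hlt _ this]

/-- A cycle all of whose arcs have cost zero. -/
structure ZeroCycle {V : Type*} (E : V → V → Prop) (c : V → V → ℝ) {g : ℕ} (ζ : ZMod g → V) :
    Prop where
  inj : Function.Injective ζ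
  arc : ∀ a, E (ζ a) (ζ (a + 1))
  cost : ∀ a, c (ζ a) (ζ (a + 1)) = 0

theorem ZeroCycle.path {V : Type*} {E : V → V → Prop} {c : V → V → ℝ} {g : ℕ} {ζ : ZMod g → V}
    (hζ : ZeroCycle E c ζ) (a : ZMod g) (m : ℕ) : CostWalk E c (ζ a) (ζ (a + m)) m 0 := by
  induction m with
  | zero => simpa using CostWalk.nil (ζ a)
  | succ m ih =>
    have h := ih.snoc (hζ.arc _)
    rw [hζ.cost, add_zero] at h
    simpa [add_assoc] using h

/-- A walk of length `L` through the cycle `ζ` of length `g` that no walk with the same ends, through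
`ζ`, of the same length modulo `g`, and of at most the same cost, undercuts in length. -/
structure OptWalk {V : Type*} (E : V → V → Prop) (c : V → V → ℝ) {g : ℕ} (ζ : ZMod g → V)
    (w : ℕ → V) (L : ℕ) : Prop where
  arc : ∀ k < L, E (w k) (w (k + 1))
  touch : ∃ k ≤ L, w k ∈ Set.range ζ
  min : ∀ a l₁ l₂ x₁ x₂, CostWalk E c (w 0) (ζ a) l₁ x₁ → CostWalk E c (ζ a) (w L) l₂ x₂ →
    l₁ + l₂ ≡ L [MOD g] → x₁ + x₂ ≤ walkCost c w 0 L → L ≤ l₁ + l₂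

/-! ### Optimal walks: bounds on the number of visits -/

section Extremal

variable {V : Type*} {E : V → V → Prop} {c : V → V → ℝ} {g : ℕ} {ζ : ZMod g → V} {w : ℕ → V}
  {L : ℕ}

/-- Cutting out the loops `[p, p')` and `[q, q')` keeps the ends and the visit of `ζ` at `k`, does
not raise the cost and changes the length by a multiple of `g`. Minimality leaves nothing to cut. -/
theorem OptWalk.excise (hc : ∀ i j, 0 ≤ c i j) (h : OptWalk E c ζ w L) {p p' k q q' : ℕ}
    (hp : p ≤ p') (hpk : p' ≤ k) (hkq : k ≤ q) (hq : q ≤ q') (hqL : q' ≤ L) (hwp : w p = w p')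
    (hwq : w q = w q') (hk : w k ∈ Set.range ζ) (hmod : (p : ZMod g) + q = p' + q') :
    p = p' ∧ q = q' := by
  obtain ⟨a, ha⟩ := hk
  have s : ∀ {p q : ℕ}, p ≤ q → q ≤ L → CostWalk E c (w p) (w q) (q - p) (walkCost c w p q) :=
    fun h1 h2 => costWalk_segment h.arc h1 h2
  have h1 := s (Nat.zero_le p) (by omega)
  rw [hwp] at h1
  have h2 := h1.append (s hpk (by omega))
  have h3 := s hkq (by omega)
  rw [hwq] at h3
  have h4 := h3.append (s hqL le_rfl)
  rw [← ha] at h2 h4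
  have hmod' : p - 0 + (k - p') + (q - k + (L - q')) ≡ L [MOD g] := by
    rw [← ZMod.natCast_eq_natCast_iff]
    have e : p - 0 + (k - p') + (q - k + (L - q')) + (p' + q') = L + (p + q) := by omega
    have e' := congrArg (Nat.cast : ℕ → ZMod g) e
    rw [Nat.cast_add, Nat.cast_add L] at e'
    push_cast at e' ⊢
    rw [hmod] at e'
    exact add_right_cancel e'
  have := h.min a _ _ _ _ h2 h4 hmod' (by
    have e1 := walkCost_add c w (Nat.zero_le p) hp
    have e2 := walkCost_add c w (Nat.zero_le p') hpk
    have e3 := walkCost_add c w (Nat.zero_le k) hkq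
    have e4 := walkCost_add c w (Nat.zero_le q) hq
    have e5 := walkCost_add c w (Nat.zero_le q') hqL
    have n1 := walkCost_nonneg hc w p p'
    have n2 := walkCost_nonneg hc w q q'
    linarith)
  omega

/-- Call `position - index` the class of a visit of `ζ`. Between two visits of one class, the walk
has modulo `g` the length of the path along `ζ`, which is free and shorter than `g`. Minimality
rules out any longer detour. -/
theorem OptWalk.sub_eq_val [NeZero g] (hc : ∀ i j, 0 ≤ c i j) (hζ : ZeroCycle E c ζ)
    (h : OptWalk E c ζ w L) {p q : ℕ} {a b : ZMod g} (hpq : p ≤ q) (hq : q ≤ L) (hp : w p = ζ a)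
    (hq' : w q = ζ b) (hab : (p : ZMod g) - a = q - b) : q - p = (b - a).val := by
  have s : ∀ {p q : ℕ}, p ≤ q → q ≤ L → CostWalk E c (w p) (w q) (q - p) (walkCost c w p q) :=
    fun h1 h2 => costWalk_segment h.arc h1 h2
  have h1 := s (Nat.zero_le p) (by omega)
  have h2 := s hq le_rfl
  rw [hp] at h1
  rw [hq'] at h2
  have h3 := hζ.path a (b - a).val
  rw [ZMod.natCast_zmod_val, add_sub_cancel] at h3
  have hcast : ((q - p : ℕ) : ZMod g) = b - a := by
    rw [Nat.cast_sub hpq]; linear_combination -hab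
  have hmod : p - 0 + ((b - a).val + (L - q)) ≡ L [MOD g] := by
    rw [← ZMod.natCast_eq_natCast_iff]
    have e : p - 0 + ((q - p) + (L - q)) = L := by omega
    have e' := congrArg (Nat.cast : ℕ → ZMod g) e
    rw [Nat.cast_add, Nat.cast_add (q - p), hcast] at e'
    rw [← e']
    push_cast
    rw [ZMod.natCast_zmod_val]
  have hle := h.min a _ _ _ _ h1 (h3.append h2) hmod (by
    have e1 := walkCost_add c w (Nat.zero_le p) hpq
    have e2 := walkCost_add c w (Nat.zero_le q) hq
    have n1 := walkCost_nonneg hc w p q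
    linarith)
  have hlt := ZMod.val_lt (b - a)
  have : q - p < g := by omega
  rw [← hcast, ZMod.val_natCast, Nat.mod_eq_of_lt this]

/-- The pairs `(p, min Y)` with `p ∈ X` and `(max X, q)` with `q ∈ Y`, `q ≠ min Y`, form a chain for
the product order, of `X.card + Y.card - 1` elements. By `excise`, comparable pairs with the same
sum modulo `g` are equal, so the sums along the chain are distinct in `ZMod g`. -/
theorem OptWalk.card_add_card_le [NeZero g] (hc : ∀ i j, 0 ≤ c i j) (h : OptWalk E c ζ w L)
    {X Y : Finset ℕ} {u v : V} {k : ℕ} (hk : w k ∈ Set.range ζ)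
    (hX : ∀ p ∈ X, p ≤ k ∧ w p = u) (hY : ∀ q ∈ Y, k ≤ q ∧ q ≤ L ∧ w q = v)
    (hXn : X.Nonempty) (hYn : Y.Nonempty) : X.card + Y.card ≤ g + 1 := by
  classical
  set x := X.max' hXn
  set y := Y.min' hYn
  have hx : x ∈ X := X.max'_mem hXn
  have hy : y ∈ Y := Y.min'_mem hYn
  have key : ∀ p ∈ X, ∀ p' ∈ X, ∀ q ∈ Y, ∀ q' ∈ Y, p ≤ p' → q ≤ q' →
      (p : ZMod g) + q = p' + q' → p = p' ∧ q = q' := fun p hp p' hp' q hq q' hq' h1 h2 h3 =>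
    h.excise hc h1 (hX p' hp').1 (hY q hq).1 h2 (hY q' hq').2.1
      ((hX p hp).2.trans (hX p' hp').2.symm) ((hY q hq).2.2.trans (hY q' hq').2.2.symm) hk h3
  have h1 : (X.image fun p : ℕ => (p : ZMod g) + y).card = X.card := by
    refine Finset.card_image_of_injOn fun p hp p' hp' e => ?_
    rcases le_total p p' with hle | hle
    · exact (key p hp p' hp' y hy y hy hle le_rfl e).1
    · exact (key p' hp' p hp y hy y hy hle le_rfl e.symm).1.symm
  have h2 : ((Y.erase y).image fun q : ℕ => (x : ZMod g) + q).card = (Y.erase y).card := by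
    refine Finset.card_image_of_injOn fun q hq q' hq' e => ?_
    have hq := Finset.mem_of_mem_erase hq
    have hq' := Finset.mem_of_mem_erase hq'
    rcases le_total q q' with hle | hle
    · exact (key x hx x hx q hq q' hq' le_rfl hle e).2
    · exact (key x hx x hx q' hq' q hq le_rfl hle e.symm).2.symm
  have hd : Disjoint (X.image fun p : ℕ => (p : ZMod g) + y)
      ((Y.erase y).image fun q : ℕ => (x : ZMod g) + q) := by
    rw [Finset.disjoint_left]
    intro t ht ht'
    obtain ⟨p, hp, rfl⟩ := Finset.mem_image.mp ht
    obtain ⟨q, hq, e⟩ := Finset.mem_image.mp ht'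
    obtain ⟨hne, hq⟩ := Finset.mem_erase.mp hq
    exact hne (key p hp x hx y hy q hq (X.le_max' p hp) (Y.min'_le q hq) e.symm).2.symm
  have h3 := Finset.card_le_univ ((X.image fun p : ℕ => (p : ZMod g) + y) ∪
    ((Y.erase y).image fun q : ℕ => (x : ZMod g) + q))
  rw [Finset.card_union_of_disjoint hd, h1, h2, ZMod.card, Finset.card_erase_of_mem hy] at h3
  have := Finset.card_pos.mpr hYn
  omega

variable [DecidableEq V]

/-- The number of positions before `k` at which `w` visits `v`. -/
def visits (w : ℕ → V) (v : V) (k : ℕ) : ℕ := ((Finset.range k).filter fun p => w p = v).card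

theorem sum_visits [Fintype V] (w : ℕ → V) (k : ℕ) : ∑ v, visits w v k = k := by
  conv_rhs => rw [← Finset.card_range k,
    Finset.card_eq_sum_card_fiberwise (f := w) (t := Finset.univ) (by simp)]
  rfl

theorem visits_add (w : ℕ → V) (v : V) {k l : ℕ} (hkl : k ≤ l) :
    visits w v k + ((Finset.Ico k l).filter fun p => w p = v).card = visits w v l := by
  rw [visits, visits, ← Finset.card_union_of_disjoint, ← Finset.filter_union]
  · congr 2
    ext p
    simp
    omega
  · refine Finset.disjoint_filter_filter (Finset.disjoint_left.mpr fun p h1 h2 => ?_)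
    simp at h1 h2
    omega

theorem visits_le_of_le (w : ℕ → V) (v : V) {k l : ℕ} (hkl : k ≤ l) :
    visits w v k ≤ visits w v l := by
  have := visits_add w v hkl
  omega

/-- The last visit `k` is itself on `ζ`, so it can serve both as the splitting point and as the only
element of `Y`. -/
theorem OptWalk.visits_cycle_le [NeZero g] (hc : ∀ i j, 0 ≤ c i j) (h : OptWalk E c ζ w L)
    (a : ZMod g) : visits w (ζ a) (L + 1) ≤ g := by
  rcases Finset.eq_empty_or_nonempty ((Finset.range (L + 1)).filter fun p => w p = ζ a) with h0 | h0
  · rw [visits, h0]; simp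
  · have hm := Finset.max'_mem _ h0
    set k := Finset.max' _ h0 with hkdef
    simp only [Finset.mem_filter, Finset.mem_range] at hm
    have := h.card_add_card_le hc (X := (Finset.range (L + 1)).filter fun p => w p = ζ a)
      (Y := {k}) (u := ζ a) (v := ζ a) (k := k) ⟨a, hm.2.symm⟩
      (fun p hp => ⟨Finset.le_max' _ p hp, (Finset.mem_filter.mp hp).2⟩)
      (fun q hq => by
        rw [Finset.mem_singleton] at hq
        subst hq
        exact ⟨le_rfl, by omega, hm.2⟩) h0 (by simp)
    rw [Finset.card_singleton] at this
    exact Nat.le_of_succ_le_succ this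

/-- The visits are split at a position `k` where the walk meets `ζ`. If one side is empty, `{k}`
stands in for it. -/
theorem OptWalk.visits_le [NeZero g] (hc : ∀ i j, 0 ≤ c i j) (h : OptWalk E c ζ w L)
    (v : V) : visits w v (L + 1) ≤ g + 1 := by
  obtain ⟨k, hkL, hk⟩ := h.touch
  have e := visits_add w v (show k ≤ L + 1 by omega)
  have hX : ∀ p ∈ (Finset.range k).filter fun p => w p = v, p ≤ k ∧ w p = v := fun p hp => by
    simp only [Finset.mem_filter, Finset.mem_range] at hp
    exact ⟨hp.1.le, hp.2⟩
  have hY : ∀ q ∈ (Finset.Ico k (L + 1)).filter fun p => w p = v, k ≤ q ∧ q ≤ L ∧ w q = v :=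
    fun q hq => by
      simp only [Finset.mem_filter, Finset.mem_Ico] at hq
      exact ⟨hq.1.1, by omega, hq.2⟩
  rw [← e]
  rcases Finset.eq_empty_or_nonempty ((Finset.range k).filter fun p => w p = v) with h0 | h0
  · rcases Finset.eq_empty_or_nonempty ((Finset.Ico k (L + 1)).filter fun p => w p = v) with h1 | h1
    · simp [visits, h0, h1]
    · have := h.card_add_card_le hc (X := {k}) (u := w k) hk (by simp) hY (by simp) h1
      rw [Finset.card_singleton] at this
      simp only [visits, h0, Finset.card_empty]
      omega
  · rcases Finset.eq_empty_or_nonempty ((Finset.Ico k (L + 1)).filter fun p => w p = v) with h1 | h1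
    · have := h.card_add_card_le hc (Y := {k}) (v := w k) hk hX (by simp [hkL]) h0 (by simp)
      rw [Finset.card_singleton] at this
      simp only [visits, h1, Finset.card_empty]
      omega
    · exact h.card_add_card_le hc hk hX hY h0 h1

end Extremal

/-! ### Walks of maximal length: the blocks -/

section Extremal

variable {V : Type*} {E : V → V → Prop} {c : V → V → ℝ} {g : ℕ} {ζ : ZMod g → V} {w : ℕ → V}
  {L : ℕ}

section Length

variable [DecidableEq V]

theorem OptWalk.visits_le_ite [NeZero g] (hc : ∀ i j, 0 ≤ c i j) (h : OptWalk E c ζ w L) (v : V) :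
    visits w v (L + 1) ≤ if v ∈ Set.range ζ then g else g + 1 := by
  split_ifs with hv
  · obtain ⟨a, rfl⟩ := hv
    exact h.visits_cycle_le hc a
  · exact h.visits_le hc v

variable [Fintype V] {M : ℕ}

theorem card_filter_mem_range [NeZero g] (hζ : Function.Injective ζ)
    (hM : Fintype.card V = M + g) :
    (Finset.univ.filter fun v => v ∈ Set.range ζ).card = g ∧
      (Finset.univ.filter fun v => v ∉ Set.range ζ).card = M := by
  have h1 : (Finset.univ.filter fun v => v ∈ Set.range ζ) = Finset.univ.image ζ := by
    ext v; simp
  have h2 : (Finset.univ.filter fun v => v ∈ Set.range ζ).card = g := by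
    rw [h1, Finset.card_image_of_injective _ hζ, Finset.card_univ, ZMod.card]
  have h3 := Finset.card_filter_add_card_filter_not (s := (Finset.univ : Finset V))
    (fun v => v ∈ Set.range ζ)
  rw [Finset.card_univ] at h3
  exact ⟨h2, by omega⟩

theorem sum_ite_mem_range [NeZero g] (hζ : Function.Injective ζ)
    (hM : Fintype.card V = M + g) (x y : ℕ) :
    ∑ v : V, (if v ∈ Set.range ζ then x else y) = g * x + M * y := by
  obtain ⟨h1, h2⟩ := card_filter_mem_range hζ hM
  rw [Finset.sum_ite, Finset.sum_const, Finset.sum_const, h1, h2, smul_eq_mul, smul_eq_mul]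

/-- The length of an optimal walk is at most `(g + 1) (n - 1)`. -/
theorem OptWalk.length_le [NeZero g] (hc : ∀ i j, 0 ≤ c i j) (hζ : ZeroCycle E c ζ)
    (h : OptWalk E c ζ w L) (hM : Fintype.card V = M + g) :
    L + 1 ≤ g * g + M * (g + 1) := by
  rw [← sum_visits w (L + 1), ← sum_ite_mem_range hζ.inj hM]
  exact Finset.sum_le_sum fun v _ => h.visits_le_ite hc v

theorem OptWalk.visits_eq_ite [NeZero g] (hc : ∀ i j, 0 ≤ c i j) (hζ : ZeroCycle E c ζ)
    (h : OptWalk E c ζ w L) (hM : Fintype.card V = M + g)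
    (hL : L + 1 = g * g + M * (g + 1)) (v : V) :
    visits w v (L + 1) = if v ∈ Set.range ζ then g else g + 1 := by
  refine (Finset.sum_eq_sum_iff_of_le fun v _ => h.visits_le_ite hc v).mp ?_ v (Finset.mem_univ v)
  rw [sum_visits, sum_ite_mem_range hζ.inj hM, hL]

end Length

/-- The positions of a walk on `n = M + g` nodes at which the cycle is visited, in the extremal
case: `g` blocks of `g` consecutive nodes of the cycle, and every node is visited at most once
between two consecutive multiples of `n`. -/
structure Blocks {V : Type*} {g : ℕ} (ζ : ZMod g → V) (M : ℕ) (w : ℕ → V) (L : ℕ) : Prop where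
  block : ∀ m < g, ∃ b, ∀ i < g, w (m * (M + g) + M + i) = ζ (b + i)
  mod_of_mem : ∀ k ≤ L, w k ∈ Set.range ζ → M ≤ k % (M + g)
  div_lt : ∀ p q, p < q → q ≤ L → w p = w q → p / (M + g) < q / (M + g)

variable [DecidableEq V] [Fintype V] {M : ℕ}

/-- In the extremal case, the visits of the cycle in a given class form a block. -/
theorem OptWalk.exists_block [NeZero g] (hc : ∀ i j, 0 ≤ c i j) (hζ : ZeroCycle E c ζ)
    (h : OptWalk E c ζ w L) (hM : Fintype.card V = M + g)
    (hL : L + 1 = g * g + M * (g + 1)) (d : ZMod g) :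
    ∃ (s : ℕ) (b : ZMod g), s + g ≤ L + 1 ∧ (s : ZMod g) - b = d ∧ ∀ i < g, w (s + i) = ζ (b + i) := by
  have hg : 0 < g := Nat.pos_of_ne_zero (NeZero.ne g)
  -- The `g` visits of `ζ a` have pairwise different classes by `sub_eq_val`, so each of the `g`
  -- classes occurs.
  have hex : ∀ a, ∃ p ≤ L, w p = ζ a ∧ (p : ZMod g) - a = d := by
    intro a
    have hcard : ((Finset.range (L + 1)).filter fun p => w p = ζ a).card = g := by
      have := h.visits_eq_ite hc hζ hM hL (ζ a)
      rwa [if_pos ⟨a, rfl⟩] at this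
    have hinj : Set.InjOn (fun p : ℕ => (p : ZMod g) - a)
        ((Finset.range (L + 1)).filter fun p => w p = ζ a) := by
      intro p hp q hq e
      simp only [Finset.coe_filter, Finset.mem_range, Set.mem_ofPred_eq] at hp hq
      rcases le_total p q with hle | hle
      · have := h.sub_eq_val hc hζ hle (by omega) hp.2 hq.2 e
        rw [sub_self, ZMod.val_zero] at this
        omega
      · have := h.sub_eq_val hc hζ hle (by omega) hq.2 hp.2 e.symm
        rw [sub_self, ZMod.val_zero] at this
        omega
    have himg := Finset.card_image_of_injOn hinj
    replace himg := (himg.trans hcard).trans (ZMod.card g).symm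
    have := (Finset.card_eq_iff_eq_univ _).mp himg
    have hd := this ▸ Finset.mem_univ d
    obtain ⟨p, hp, e⟩ := Finset.mem_image.mp hd
    simp only [Finset.mem_filter, Finset.mem_range] at hp
    exact ⟨p, by omega, hp.2, e⟩
  choose pos hpL hw hd using hex
  obtain ⟨b, hb⟩ := Finite.exists_min pos
  -- Measured from the earliest visit of the class, `sub_eq_val` gives the positions of all others:
  -- they form one uninterrupted turn.
  have hpos : ∀ i < g, pos (b + i) = pos b + i := by
    intro i hi
    have := h.sub_eq_val hc hζ (hb (b + i)) (hpL _) (hw b) (hw (b + i)) ((hd b).trans (hd _).symm)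
    rw [add_sub_cancel_left, ZMod.val_natCast, Nat.mod_eq_of_lt hi] at this
    have := hb (b + i)
    omega
  refine ⟨pos b, b, ?_, hd b, fun i hi => by rw [← hpos i hi, hw]⟩
  have h1 := hpos (g - 1) (by omega)
  have h2 := hpL (b + (g - 1 : ℕ))
  omega

/-- Let `s d` be the start of the block of class `d` and `m d` the number of blocks starting before
it. Before `s d`, a node of `ζ` has been visited `m d` times. For a node off `ζ`, `card_add_card_le`
at the two ends of the block allows at most `m d + 1` visits before it and `g - m d` after it; the
total is `g + 1`, so both are attained. Summing over all nodes gives `s d = m d * (M + g) + M`. -/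
theorem OptWalk.blocks [NeZero g] (hc : ∀ i j, 0 ≤ c i j) (hζ : ZeroCycle E c ζ)
    (h : OptWalk E c ζ w L) (hM : Fintype.card V = M + g)
    (hL : L + 1 = g * g + M * (g + 1)) : Blocks ζ M w L := by
  have hg : 0 < g := Nat.pos_of_ne_zero (NeZero.ne g)
  choose s b hsL hsd hs using h.exists_block hc hζ hM hL
  -- every visit of the cycle lies in one of the blocks
  have huniq : ∀ k ≤ L, ∀ a, w k = ζ a → k = s (k - a) + (a - b (k - a)).val := by
    intro k hk a ha
    set d := (k : ZMod g) - a with hdd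
    have hlt := ZMod.val_lt (a - b d)
    have hw := hs d _ hlt
    rw [ZMod.natCast_zmod_val, add_sub_cancel] at hw
    have hcl : ((s d + (a - b d).val : ℕ) : ZMod g) - a = k - a := by
      push_cast
      rw [ZMod.natCast_zmod_val, ← hdd]
      linear_combination hsd d
    have hle := hsL d
    rcases le_total k (s d + (a - b d).val) with h1 | h1
    · have := h.sub_eq_val hc hζ h1 (by omega) ha hw hcl.symm
      rw [sub_self, ZMod.val_zero] at this
      omega
    · have := h.sub_eq_val hc hζ h1 (by omega) hw ha hcl
      rw [sub_self, ZMod.val_zero] at this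
      omega
  -- A block that starts inside another one has the same class there, so distinct blocks are
  -- disjoint.
  have hdisj : ∀ d e, ∀ i < g, s e = s d + i → d = e := by
    intro d e i hi he
    have h1 := hs d i hi
    have h2 := hs e 0 hg
    rw [add_zero, he, h1] at h2
    have h3 := hζ.inj h2
    rw [Nat.cast_zero, add_zero] at h3
    rw [← hsd d, ← hsd e, ← h3, he]
    push_cast
    ring
  have hstep : ∀ d e, s d < s e → s d + g ≤ s e := by
    intro d e hlt
    by_contra hcon
    have := hdisj d e (s e - s d) (by omega) (by omega)
    subst this
    omega
  set m : ZMod g → ℕ := fun d => (Finset.univ.filter fun e => s e < s d).card with hm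
  have hmlt : ∀ d, m d < g := by
    intro d
    calc m d < (Finset.univ : Finset (ZMod g)).card := Finset.card_lt_card
          ⟨Finset.subset_univ _, fun hcon => by
            have := hcon (Finset.mem_univ d)
            simp at this⟩
      _ = g := by rw [Finset.card_univ, ZMod.card]
  -- visits of the cycle before and after a block
  have hbefore : ∀ a k, k ≤ L + 1 → visits w (ζ a) k =
      (Finset.univ.filter fun e => s e + (a - b e).val < k).card := by
    intro a k hk
    symm
    refine Finset.card_bij (fun e _ => s e + (a - b e).val) ?_ ?_ ?_
    · intro e he
      simp only [Finset.mem_filter, Finset.mem_univ, true_and, Finset.mem_range] at he ⊢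
      refine ⟨he, ?_⟩
      rw [hs e _ (ZMod.val_lt _), ZMod.natCast_zmod_val, add_sub_cancel]
    · intro e _ e' _ heq
      have := congrArg (Nat.cast : ℕ → ZMod g) heq
      push_cast at this
      rw [ZMod.natCast_zmod_val, ZMod.natCast_zmod_val] at this
      linear_combination this - hsd e + hsd e'
    · intro p hp
      simp only [Finset.mem_filter, Finset.mem_range] at hp
      have := huniq p (by omega) a hp.2
      exact ⟨p - a, by simp [← this, hp.1], this.symm⟩
  have hz1 : ∀ d a, visits w (ζ a) (s d) = m d := by
    intro d a
    rw [hbefore a _ (by have := hsL d; omega)]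
    congr 1
    refine Finset.filter_congr fun e _ => ⟨fun h1 => by omega, fun h1 => ?_⟩
    have := hstep e d h1
    have := ZMod.val_lt (a - b e)
    omega
  have hz2 : ∀ d a, visits w (ζ a) (s d + g) = m d + 1 := by
    intro d a
    rw [hbefore a _ (hsL d), hm, ← Finset.card_insert_of_notMem (a := d) (by simp)]
    congr 1
    ext e
    simp only [Finset.mem_filter, Finset.mem_univ, true_and, Finset.mem_insert]
    have hlt := ZMod.val_lt (a - b e)
    refine ⟨fun h1 => ?_, ?_⟩
    · by_cases he : s e < s d
      · exact Or.inr he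
      · left
        exact (hdisj d e (s e - s d) (by omega) (by omega)).symm
    · rintro (rfl | h1)
      · omega
      · have := hstep e d h1
        omega
  have hv : ∀ d, ∀ v ∉ Set.range ζ, visits w v (s d) = m d + 1 := by
    intro d v hv
    have hle := hsL d
    have htot := h.visits_eq_ite hc hζ hM hL v
    rw [if_neg hv] at htot
    have hw0 := hs d 0 hg
    rw [add_zero] at hw0
    have hw1 := hs d (g - 1) (by omega)
    have hnone : ((Finset.Ico (s d) (s d + (g - 1))).filter fun p => w p = v) = ∅ := by
      rw [Finset.filter_eq_empty_iff]
      intro p hp e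
      rw [Finset.mem_Ico] at hp
      have := hs d (p - s d) (by omega)
      rw [show s d + (p - s d) = p by omega, e] at this
      exact hv ⟨_, this.symm⟩
    have e1 := visits_add w v (show s d ≤ s d + (g - 1) by omega)
    rw [hnone, Finset.card_empty] at e1
    have e2 := visits_add w v (show s d + (g - 1) ≤ L + 1 by omega)
    -- From `s d` on, `ζ (b d)` still has `g - m d` visits.
    have hupper : visits w v (s d) ≤ m d + 1 := by
      rcases Finset.eq_empty_or_nonempty ((Finset.range (s d)).filter fun p => w p = v) with h0 | h0
      · simp [visits, h0]
      · have e3 := visits_add w (ζ (b d)) (show s d ≤ L + 1 by omega)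
        have e4 := h.visits_eq_ite hc hζ hM hL (ζ (b d))
        rw [if_pos ⟨_, rfl⟩] at e4
        rw [hz1, e4] at e3
        have := hmlt d
        have h5 := h.card_add_card_le hc (u := v) (v := ζ (b d)) (k := s d)
          (X := (Finset.range (s d)).filter fun p => w p = v)
          (Y := (Finset.Ico (s d) (L + 1)).filter fun p => w p = ζ (b d)) ⟨_, hw0.symm⟩
          (fun p hp => by
            simp only [Finset.mem_filter, Finset.mem_range] at hp
            exact ⟨hp.1.le, hp.2⟩)
          (fun q hq => by
            simp only [Finset.mem_filter, Finset.mem_Ico] at hq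
            exact ⟨hq.1.1, by omega, hq.2⟩) h0 (Finset.card_pos.mp (by omega))
        rw [visits]
        omega
    -- Up to the last position of the block, `ζ (b d)` has had `m d + 1` visits.
    have hlower : ((Finset.Ico (s d + (g - 1)) (L + 1)).filter fun p => w p = v).card ≤ g - m d := by
      rcases Finset.eq_empty_or_nonempty
        ((Finset.Ico (s d + (g - 1)) (L + 1)).filter fun p => w p = v) with h0 | h0
      · simp [h0]
      · have h6 := hz2 d (b d)
        have h5 := h.card_add_card_le hc (u := ζ (b d)) (v := v) (k := s d + (g - 1))
          (X := (Finset.range (s d + g)).filter fun p => w p = ζ (b d))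
          (Y := (Finset.Ico (s d + (g - 1)) (L + 1)).filter fun p => w p = v) ⟨_, hw1.symm⟩
          (fun p hp => by
            simp only [Finset.mem_filter, Finset.mem_range] at hp
            exact ⟨by omega, hp.2⟩)
          (fun q hq => by
            simp only [Finset.mem_filter, Finset.mem_Ico] at hq
            exact ⟨hq.1.1, by omega, hq.2⟩)
          (Finset.card_pos.mp (by rw [← visits]; omega)) h0
        rw [← visits, h6] at h5
        omega
    have := hmlt d
    omega
  have hsm : ∀ d, s d = m d * (M + g) + M := by
    intro d
    have e1 : ∑ v, visits w v (s d) = ∑ v : V, if v ∈ Set.range ζ then m d else m d + 1 := by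
      refine Finset.sum_congr rfl fun v _ => ?_
      split_ifs with hv'
      · obtain ⟨a, rfl⟩ := hv'
        exact hz1 d a
      · exact hv d v hv'
    rw [sum_visits, sum_ite_mem_range hζ.inj hM] at e1
    rw [e1]
    ring
  have hsurj : ∀ k < g, ∃ d, m d = k := by
    have hinj : Function.Injective fun d => (⟨m d, hmlt d⟩ : Fin g) := by
      intro d e hde
      have hde : m d = m e := congrArg Fin.val hde
      exact hdisj d e 0 hg (by rw [hsm d, hsm e, hde, add_zero])
    have hbij := (Fintype.bijective_iff_injective_and_card _).mpr
      ⟨hinj, by rw [ZMod.card, Fintype.card_fin]⟩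
    intro k hk
    obtain ⟨d, hd⟩ := hbij.2 ⟨k, hk⟩
    exact ⟨d, congrArg Fin.val hd⟩
  have hblock : ∀ k < g, ∃ b, ∀ i < g, w (k * (M + g) + M + i) = ζ (b + i) := by
    intro k hk
    obtain ⟨d, rfl⟩ := hsurj k hk
    exact ⟨b d, fun i hi => by rw [← hsm]; exact hs d i hi⟩
  have hmod : ∀ k ≤ L, w k ∈ Set.range ζ → M ≤ k % (M + g) := by
    rintro k hk ⟨a, ha⟩
    have := huniq k hk a ha.symm
    have hlt := ZMod.val_lt (a - b (k - a))
    rw [this, hsm, mul_comm, add_assoc, Nat.mul_add_mod, Nat.mod_eq_of_lt (by omega)]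
    omega
  have hvis : ∀ v ∉ Set.range ζ, ∀ k ≤ g, k ≤ visits w v (k * (M + g)) := by
    intro v hvr k hk
    cases k with
    | zero => simp
    | succ k =>
      obtain ⟨d, hd⟩ := hsurj k (by omega)
      calc k + 1 = visits w v (s d) := by rw [hv d v hvr, hd]
        _ ≤ _ := visits_le_of_le w v (by rw [hsm, hd, Nat.succ_mul]; omega)
  refine ⟨hblock, hmod, ?_⟩
  intro p q hpq hq hw
  refine lt_of_le_of_ne (Nat.div_le_div_right hpq.le) fun hdiv => ?_
  have hp' := Nat.div_add_mod p (M + g)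
  have hq' := Nat.div_add_mod q (M + g)
  have hqlt := Nat.mod_lt q (show 0 < M + g by omega)
  have hplt := Nat.mod_lt p (show 0 < M + g by omega)
  have hLn : L + 1 = g * (M + g) + M := by rw [hL]; ring
  rw [hdiv] at hp'
  set k := q / (M + g) with hk
  rw [mul_comm] at hp' hq'
  by_cases hr : w q ∈ Set.range ζ
  · have h1 := hmod q hq hr
    have h2 := hmod p (by omega) (hw ▸ hr)
    have hkg : k < g := by
      by_contra hcon
      have : g * (M + g) ≤ k * (M + g) := Nat.mul_le_mul_right _ (by omega)
      omega
    obtain ⟨b', hb'⟩ := hblock k hkg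
    have h3 := hb' (p % (M + g) - M) (by omega)
    have h4 := hb' (q % (M + g) - M) (by omega)
    rw [show k * (M + g) + M + (p % (M + g) - M) = p by omega] at h3
    rw [show k * (M + g) + M + (q % (M + g) - M) = q by omega] at h4
    have h5 := hζ.inj (h3.symm.trans (hw.trans h4))
    have h6 := add_left_cancel h5
    have h7 := congrArg ZMod.val h6
    rw [ZMod.val_natCast, ZMod.val_natCast,
      Nat.mod_eq_of_lt (show p % (M + g) - M < g by omega),
      Nat.mod_eq_of_lt (show q % (M + g) - M < g by omega)] at h7
    omega
  · have hkg : k ≤ g := by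
      by_contra hcon
      have : (g + 1) * (M + g) ≤ k * (M + g) := Nat.mul_le_mul_right _ (by omega)
      rw [Nat.succ_mul] at this
      omega
    have hk0 := hvis (w q) hr k hkg
    -- Two further visits, on top of at least `k` before `k * (M + g)`, exceed the `k + 1` counted
    -- at the start of the next block or, for `k = g`, the `g + 1` of the whole walk.
    have two : ∀ t, q < t → visits w (w q) (k * (M + g)) + 2 ≤ visits w (w q) t := by
      intro t ht
      rw [← visits_add w (w q) (show k * (M + g) ≤ t by omega)]
      refine Nat.add_le_add_left ?_ _
      rw [← Finset.card_pair hpq.ne]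
      refine Finset.card_le_card fun x hx => ?_
      simp only [Finset.mem_insert, Finset.mem_singleton] at hx
      simp only [Finset.mem_filter, Finset.mem_Ico]
      rcases hx with rfl | rfl
      · exact ⟨by omega, hw⟩
      · exact ⟨by omega, rfl⟩
    rcases Nat.lt_or_ge k g with hkg' | hkg'
    · obtain ⟨d, hd⟩ := hsurj k hkg'
      have h1 := hv d (w q) hr
      have hqM : q % (M + g) < M := by
        by_contra hcon
        obtain ⟨b', hb'⟩ := hblock k hkg'
        have h4 := hb' (q % (M + g) - M) (by omega)
        rw [show k * (M + g) + M + (q % (M + g) - M) = q by omega] at h4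
        exact hr ⟨_, h4.symm⟩
      have := two (s d) (by rw [hsm, hd]; omega)
      omega
    · have h1 := h.visits_eq_ite hc hζ hM hL (w q)
      rw [if_neg hr] at h1
      have := two (L + 1) (by omega)
      omega

end Extremal

/-- The map on positions that exchanges the segments `[p, q)` and `[q, r)`. -/
def loopSwap (p q r k : ℕ) : ℕ :=
  if k < p then k else if k < p + (r - q) then k + (q - p) else if k < r then k - (r - q) else k

/-! ### Exchanging loops, and periodicity -/

section Extremal

variable {V : Type*} {E : V → V → Prop} {c : V → V → ℝ} {g : ℕ} {ζ : ZMod g → V} {w : ℕ → V}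
  {L : ℕ}

theorem loopSwap_loopSwap {p q r : ℕ} (hpq : p < q) (hqr : q < r) (k : ℕ) :
    loopSwap p q r (loopSwap p (p + (r - q)) r k) = k := by
  simp only [loopSwap]
  split_ifs <;> omega

theorem loopSwap_loopSwap' {p q r : ℕ} (hpq : p < q) (hqr : q < r) (k : ℕ) :
    loopSwap p (p + (r - q)) r (loopSwap p q r k) = k := by
  simp only [loopSwap]
  split_ifs <;> omega

theorem apply_loopSwap_succ {p q r : ℕ} (hpq : p < q) (hqr : q < r) (h₁ : w p = w q)
    (h₂ : w q = w r) (k : ℕ) : w (loopSwap p q r (k + 1)) = w (loopSwap p q r k + 1) := by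
  simp only [loopSwap]
  split_ifs with a b c d e f i j l
  all_goals first | omega | rfl | skip
  all_goals first | (congr 1; omega) | skip
  -- Only the three seams are left: entering the first loop, passing to the second, leaving it.
  · rw [show k + 1 + (q - p) = q by omega, show k + 1 = p by omega, h₁]
  · rw [show k + 1 - (r - q) = p by omega, show k + (q - p) + 1 = r by omega, h₁, h₂]
  · rw [show k + 1 = r by omega, show k - (r - q) + 1 = q by omega, h₂]

theorem apply_loopSwap_left {p q r : ℕ} (hpq : p < q) (hqr : q < r) (h₁ : w p = w q)
    (h₂ : w q = w r) {i : ℕ} (hi : i ≤ r - q) : w (loopSwap p q r (p + i)) = w (q + i) := by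
  rcases hi.lt_or_eq with hi | rfl
  · congr 1
    simp only [loopSwap]
    split_ifs <;> omega
  · rw [show q + (r - q) = r by omega, ← h₂, ← h₁]
    congr 1
    simp only [loopSwap]
    split_ifs <;> omega

theorem apply_loopSwap_right {p q r : ℕ} (hpq : p < q) (hqr : q < r) (h₂ : w q = w r) {i : ℕ}
    (hi : i ≤ q - p) : w (loopSwap p q r (r - i)) = w (q - i) := by
  rcases Nat.eq_zero_or_pos i with rfl | hi0
  · rw [Nat.sub_zero, Nat.sub_zero, h₂]
    congr 1
    simp only [loopSwap]
    split_ifs <;> omega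
  · congr 1
    simp only [loopSwap]
    split_ifs <;> omega

/-- Exchanging two consecutive loops of an optimal walk gives an optimal walk. -/
theorem OptWalk.loopSwap (h : OptWalk E c ζ w L) {p q r : ℕ} (hpq : p < q) (hqr : q < r)
    (hr : r ≤ L) (h₁ : w p = w q) (h₂ : w q = w r) :
    OptWalk E c ζ (fun k => w (loopSwap p q r k)) L := by
  have hsucc := apply_loopSwap_succ hpq hqr h₁ h₂
  have hlt : ∀ k < L, MaxPlus.loopSwap p q r k < L := fun k hk => by
    simp only [MaxPlus.loopSwap]; split_ifs <;> omega
  have hlt' : ∀ k < L, MaxPlus.loopSwap p (p + (r - q)) r k < L := fun k hk => by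
    simp only [MaxPlus.loopSwap]; split_ifs <;> omega
  have hcost : walkCost c (fun k => w (MaxPlus.loopSwap p q r k)) 0 L = walkCost c w 0 L := by
    refine Finset.sum_nbij' (MaxPlus.loopSwap p q r) (MaxPlus.loopSwap p (p + (r - q)) r)
      (fun k hk => ?_) (fun k hk => ?_) (fun k _ => loopSwap_loopSwap' hpq hqr k)
      (fun k _ => loopSwap_loopSwap hpq hqr k) (fun k _ => ?_)
    · simpa using hlt k (by simpa using hk)
    · simpa using hlt' k (by simpa using hk)
    · simp only [hsucc]
  have h0 : w (MaxPlus.loopSwap p q r 0) = w 0 := by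
    simp only [MaxPlus.loopSwap]
    split_ifs
    · rfl
    · rw [show 0 + (q - p) = q by omega, ← h₁, show p = 0 by omega]
    all_goals omega
  have hL : w (MaxPlus.loopSwap p q r L) = w L := by
    simp only [MaxPlus.loopSwap]
    split_ifs <;> first | omega | rfl
  refine ⟨fun k hk => ?_, ?_, ?_⟩
  · simp only [hsucc]
    exact h.arc _ (hlt k hk)
  · obtain ⟨k, hk, hw⟩ := h.touch
    rcases hk.lt_or_eq with hk | rfl
    · exact ⟨_, (hlt' k hk).le, by simpa only [loopSwap_loopSwap hpq hqr] using hw⟩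
    · exact ⟨k, le_rfl, by simpa only [hL] using hw⟩
  · intro a l₁ l₂ x₁ x₂ e₁ e₂ hm hx
    simp only [h0] at e₁
    simp only [hL] at e₂
    rw [hcost] at hx
    exact h.min a l₁ l₂ x₁ x₂ e₁ e₂ hm hx

/-- A loop of length divisible by `g` that ends no later than a visit of `ζ` could be excised alone.
-/
theorem OptWalk.natCast_ne [NeZero g] (hc : ∀ i j, 0 ≤ c i j) (h : OptWalk E c ζ w L) {p q k : ℕ}
    (hpq : p < q) (hqk : q ≤ k) (hk : k ≤ L) (hw : w p = w q) (hwk : w k ∈ Set.range ζ) :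
    (p : ZMod g) ≠ q := fun e =>
  hpq.ne (h.excise hc hpq.le hqk le_rfl le_rfl hk hw rfl hwk (by rw [e])).1

theorem exists_mod_eq_of_div_lt {n p q : ℕ} (hn : 0 < n) (h : p / n < q / n) :
    ∃ x, p ≤ x ∧ x + 1 ≤ q ∧ x % n = n - 1 := by
  have hp := Nat.div_add_mod p n
  have hq := Nat.div_add_mod q n
  have hlt := Nat.mod_lt p hn
  have hle : n * (p / n + 1) ≤ n * (q / n) := Nat.mul_le_mul_left _ h
  rw [Nat.mul_add, mul_one] at hle
  refine ⟨n * (p / n) + (n - 1), by omega, by omega, ?_⟩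
  rw [Nat.mul_add_mod, Nat.mod_eq_of_lt (by omega)]

variable [DecidableEq V] [Fintype V] {M : ℕ}

/-- If there are nodes outside the cycle, then three visits of a node in an extremal walk are at
positions that are congruent modulo `n`. -/
theorem OptWalk.mod_eq_of_three_visits [NeZero g] (hc : ∀ i j, 0 ≤ c i j)
    (hζ : ZeroCycle E c ζ) (h : OptWalk E c ζ w L) (hM : Fintype.card V = M + g)
    (hL : L + 1 = g * g + M * (g + 1)) (hM0 : 0 < M) {p q r : ℕ} (hpq : p < q) (hqr : q < r)
    (hr : r ≤ L) (h₁ : w p = w q) (h₂ : w q = w r) :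
    p % (M + g) = q % (M + g) ∧ r % (M + g) = q % (M + g) := by
  have hg : 0 < g := Nat.pos_of_ne_zero (NeZero.ne g)
  have hLn : L + 1 = g * (M + g) + M := by rw [hL]; ring
  have hB := h.blocks hc hζ hM hL
  have hB' := (h.loopSwap hpq hqr hr h₁ h₂).blocks hc hζ hM hL
  have hiff : ∀ {v : ℕ → V}, Blocks ζ M v L → ∀ k ≤ L, v k ∈ Set.range ζ ↔ M ≤ k % (M + g) := by
    intro v hv k hk
    refine ⟨hv.mod_of_mem k hk, fun hmod => ?_⟩
    have e := Nat.div_add_mod k (M + g)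
    have hlt := Nat.mod_lt k (show 0 < M + g by omega)
    rw [mul_comm] at e
    have hkg : k / (M + g) < g := by
      by_contra hcon
      have : g * (M + g) ≤ k / (M + g) * (M + g) := Nat.mul_le_mul_right _ (by omega)
      omega
    obtain ⟨b, hb⟩ := hv.block _ hkg
    have := hb (k % (M + g) - M) (by omega)
    rw [show k / (M + g) * (M + g) + M + (k % (M + g) - M) = k by omega] at this
    exact ⟨_, this.symm⟩
  -- two positions with the same pattern of visits across a multiple of `n` are congruent
  have hcross : ∀ x y : ℕ, x ≤ L → y ≤ L → x % (M + g) = M + g - 1 →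
      (w x ∈ Set.range ζ ↔ M ≤ y % (M + g)) → (w (x + 1) ∈ Set.range ζ ↔ M ≤ (y + 1) % (M + g)) →
      x + 1 ≤ L → y % (M + g) = x % (M + g) := by
    intro x y hx hy hxm h1 h2 hx1
    rw [hiff hB x hx] at h1
    rw [hiff hB _ hx1] at h2
    have hlt := Nat.mod_lt y (show 0 < M + g by omega)
    rw [Nat.add_mod_eq_ite, Nat.add_mod_eq_ite] at h2
    have h1m : 1 % (M + g) = 1 := Nat.mod_eq_of_lt (by omega)
    rw [h1m] at h2
    split_ifs at h2 <;> omega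
  -- Successive visits lie in different windows of length `M + g`, so each loop contains the passage
  -- from the end of a block to the next node, which is off the cycle because `M > 0`.
  obtain ⟨x, hx1, hx2, hx3⟩ : ∃ x, q ≤ x ∧ x + 1 ≤ r ∧ x % (M + g) = M + g - 1 :=
    exists_mod_eq_of_div_lt (by omega) (hB.div_lt q r hqr hr h₂)
  obtain ⟨y, hy1, hy2, hy3⟩ : ∃ y, p ≤ y ∧ y + 1 ≤ q ∧ y % (M + g) = M + g - 1 :=
    exists_mod_eq_of_div_lt (by omega) (hB.div_lt p q hpq (by omega) h₁)
  constructor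
  -- The exchange carries the passage at `x` to `p + (x - q)`, where the new walk must also leave a
  -- block. Hence the shift `q - p` is a multiple of the period.
  · have e1 := hiff hB' (p + (x - q)) (by omega)
    have e2 := hiff hB' (p + (x + 1 - q)) (by omega)
    simp only [apply_loopSwap_left hpq hqr h₁ h₂ (show x - q ≤ r - q by omega),
      apply_loopSwap_left hpq hqr h₁ h₂ (show x + 1 - q ≤ r - q by omega)] at e1 e2
    rw [show q + (x - q) = x by omega] at e1
    rw [show q + (x + 1 - q) = x + 1 by omega, show p + (x + 1 - q) = p + (x - q) + 1 by omega] at e2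
    have := hcross x (p + (x - q)) (by omega) (by omega) hx3 e1 e2 (by omega)
    have h3 : p + (x - q) ≡ q + (x - q) [MOD (M + g)] := by
      rw [show q + (x - q) = x by omega]; exact this
    exact Nat.ModEq.add_right_cancel' _ h3
  -- The other loop now ends at `r` instead of `q`, and its passage at `y` is carried along.
  · have e1 := hiff hB' (r - (q - y)) (by omega)
    have e2 := hiff hB' (r - (q - (y + 1))) (by omega)
    simp only [apply_loopSwap_right hpq hqr h₂ (show q - y ≤ q - p by omega),
      apply_loopSwap_right hpq hqr h₂ (show q - (y + 1) ≤ q - p by omega)] at e1 e2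
    rw [show q - (q - y) = y by omega] at e1
    rw [show q - (q - (y + 1)) = y + 1 by omega,
      show r - (q - (y + 1)) = r - (q - y) + 1 by omega] at e2
    have := hcross y (r - (q - y)) (by omega) (by omega) hy3 e1 e2 (by omega)
    have h3 : r - (q - y) + (q - y) ≡ y + (q - y) [MOD (M + g)] := Nat.ModEq.add_right _ this
    rw [show r - (q - y) + (q - y) = r by omega, show y + (q - y) = q by omega] at h3
    exact h3

/-- If the cycle has length two, then the extremal walks traverse it in the same way both times. -/
theorem OptWalk.exists_block_of_two {ζ : ZMod 2 → V} (hc : ∀ i j, 0 ≤ c i j)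
    (hζ : ZeroCycle E c ζ) (h : OptWalk E c ζ w L) (hM : Fintype.card V = M + 2)
    (hL : L + 1 = 2 * 2 + M * (2 + 1)) (hM0 : 0 < M) :
    ∃ b, ∀ m < 2, ∀ i < 2, w (m * (M + 2) + M + i) = ζ (b + i) := by
  have hB := h.blocks hc hζ hM hL
  obtain ⟨b₀, h0⟩ := hB.block 0 (by omega)
  obtain ⟨b₁, h1⟩ := hB.block 1 (by omega)
  suffices hb : b₁ = b₀ by
    subst hb
    exact ⟨b₁, fun m hm => by interval_cases m <;> assumption⟩
  have hr : w 0 ∉ Set.range ζ := fun hcon => by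
    have := hB.mod_of_mem 0 (by omega) hcon
    rw [Nat.zero_mod] at this
    omega
  -- The node `w 0`, off the cycle, has three visits, all at multiples of `M + 2`. Only `0`, `M + 2`
  -- and `2 * (M + 2)` are available.
  have hw : w (M + 2) = w 0 := by
    have hvis := h.visits_eq_ite hc hζ hM hL (w 0)
    rw [if_neg hr, visits] at hvis
    have hmem : 0 ∈ (Finset.range (L + 1)).filter fun k => w k = w 0 := by simp
    have hmod : ∀ k ∈ (Finset.range (L + 1)).filter fun k => w k = w 0, k % (M + 2) = 0 := by
      intro k hk
      by_contra hk0
      have hk0' : 0 ≠ k := by rintro rfl; simp at hk0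
      obtain ⟨r, hr, hrn⟩ := Finset.exists_mem_notMem_of_card_lt_card
        (lt_of_le_of_lt (Finset.card_le_two (a := 0) (b := k)) (by rw [hvis]; omega))
      simp only [Finset.mem_filter, Finset.mem_range] at hr hk
      simp only [Finset.mem_insert, Finset.mem_singleton, not_or] at hrn
      rcases lt_or_gt_of_ne hrn.2 with h2 | h2
      · have := h.mod_eq_of_three_visits hc hζ hM hL hM0 (p := 0) (q := r) (r := k) (by omega) h2
          (by omega) hr.2.symm (hr.2.trans hk.2.symm)
        rw [this.2, ← this.1] at hk0
        exact hk0 (Nat.zero_mod _)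
      · have := h.mod_eq_of_three_visits hc hζ hM hL hM0 (p := 0) (q := k) (r := r) (by omega) h2
          (by omega) hk.2.symm (hk.2.trans hr.2.symm)
        rw [← this.1] at hk0
        exact hk0 (Nat.zero_mod _)
    have hsub : ((Finset.range (L + 1)).filter fun k => w k = w 0) ⊆
        {0, M + 2, 2 * (M + 2)} := by
      intro k hk
      have hkm := hmod k hk
      simp only [Finset.mem_filter, Finset.mem_range] at hk
      obtain ⟨t, rfl⟩ := Nat.dvd_of_mod_eq_zero hkm
      have ht : t < 3 := by
        by_contra hcon
        have : (M + 2) * 3 ≤ (M + 2) * t := Nat.mul_le_mul_left _ (by omega)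
        omega
      interval_cases t <;> simp [mul_comm]
    have heq := Finset.eq_of_subset_of_card_le hsub (by rw [hvis]; exact Finset.card_le_three)
    have : M + 2 ∈ (Finset.range (L + 1)).filter fun k => w k = w 0 := by rw [heq]; simp
    exact (Finset.mem_filter.mp this).2
  by_contra hb
  have two : ∀ x : ZMod 2, x = 0 ∨ x = 1 := by decide
  have h2 := h1 1 (by omega)
  have h3 := h0 1 (by omega)
  have h4 := h1 0 (by omega)
  have hb' : b₁ = b₀ + 1 := by
    revert hb; generalize b₀ = x; generalize b₁ = y; revert x y; decide
  -- If the blocks started at different nodes, there would be loops of lengths `M + 2` and `M + 1`,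
  -- each ending no later than a visit of `ζ`. One of these lengths is even.
  have e1 := h.natCast_ne hc (p := 0) (q := M + 2) (by omega) (k := 1 * (M + 2) + M + 1) (by omega)
    (by omega) hw.symm ⟨_, h2.symm⟩
  have e2 := h.natCast_ne hc (p := 0 * (M + 2) + M + 1) (q := 1 * (M + 2) + M + 0) (by omega)
    le_rfl (by omega) (by rw [h3, h4, hb']; simp) ⟨_, h4.symm⟩
  push_cast at e1 e2
  revert e1 e2
  generalize (M : ZMod 2) = x
  revert x
  decide

/-- The extremal walks are periodic with period `n`. -/
theorem OptWalk.mod_eq_of_eq [NeZero g] (hc : ∀ i j, 0 ≤ c i j)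
    (hζ : ZeroCycle E c ζ) (h : OptWalk E c ζ w L) (hM : Fintype.card V = M + g)
    (hL : L + 1 = g * g + M * (g + 1)) (hg : 2 ≤ g) (hM0 : 0 < M) {p q : ℕ}
    (hp : p ≤ L) (hq : q ≤ L) (hpq : w p = w q) : p % (M + g) = q % (M + g) := by
  have hLn : L + 1 = g * (M + g) + M := by rw [hL]; ring
  have three : 3 ≤ visits w (w p) (L + 1) → p % (M + g) = q % (M + g) := by
    intro h3
    have hcard : ({p, q} : Finset ℕ).card <
        ((Finset.range (L + 1)).filter fun k => w k = w p).card :=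
      lt_of_le_of_lt Finset.card_le_two h3
    obtain ⟨r, hr, hrn⟩ := Finset.exists_mem_notMem_of_card_lt_card hcard
    simp only [Finset.mem_filter, Finset.mem_range] at hr
    simp only [Finset.mem_insert, Finset.mem_singleton, not_or] at hrn
    obtain ⟨hrL, hwr⟩ := hr
    have key := fun {x y z : ℕ} => h.mod_eq_of_three_visits (p := x) (q := y) (r := z) hc hζ hM hL hM0
    have hwrq := hwr.trans hpq
    rcases lt_trichotomy p q with h1 | rfl | h1
    · rcases lt_or_gt_of_ne hrn.1 with h2 | h2
      · exact (key h2 h1 hq hwr hpq).2.symm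
      · rcases lt_or_gt_of_ne hrn.2 with h4 | h4
        · have := key h2 h4 hq hwr.symm hwrq
          exact this.1.trans this.2.symm
        · exact (key h1 h4 (by omega) hpq hwrq.symm).1
    · rfl
    · rcases lt_or_gt_of_ne hrn.2 with h2 | h2
      · exact (key h2 h1 hp hwrq hpq.symm).2
      · rcases lt_or_gt_of_ne hrn.1 with h4 | h4
        · have := key h2 h4 hp hwrq.symm hwr
          exact this.2.trans this.1.symm
        · exact (key h1 h4 (by omega) hpq.symm hwr.symm).1.symm
  have hvis := h.visits_eq_ite hc hζ hM hL
  by_cases hr : w p ∈ Set.range ζ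
  swap
  · refine three ?_
    rw [hvis, if_neg hr]
    omega
  -- A node of the cycle has only `g` visits. For `g = 2` there is no third one, and the alignment
  -- of the two blocks takes its place.
  rcases hg.lt_or_eq with hg3 | rfl
  · refine three ?_
    rw [hvis, if_pos hr]
    omega
  have hB := h.blocks hc hζ hM hL
  obtain ⟨b, hb⟩ := h.exists_block_of_two hc hζ hM hL hM0
  have hform : ∀ k ≤ L, w k ∈ Set.range ζ → w k = ζ (b + (k % (M + 2) - M : ℕ)) := by
    intro k hk hkr
    have h1 := hB.mod_of_mem k hk hkr
    have e := Nat.div_add_mod k (M + 2)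
    have hlt := Nat.mod_lt k (show 0 < M + 2 by omega)
    rw [mul_comm] at e
    have hk2 : k / (M + 2) < 2 := by
      by_contra hcon
      have : 2 * (M + 2) ≤ k / (M + 2) * (M + 2) := Nat.mul_le_mul_right _ (by omega)
      omega
    rw [← hb _ hk2 _ (show k % (M + 2) - M < 2 by omega)]
    congr 1
    omega
  have h1 := hform p hp hr
  have h2 := hform q hq (hpq ▸ hr)
  have h3 := add_left_cancel (hζ.inj (h1.symm.trans (hpq.trans h2)))
  have h4 := congrArg ZMod.val h3
  have h5 := Nat.mod_lt p (show 0 < M + 2 by omega)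
  have h6 := Nat.mod_lt q (show 0 < M + 2 by omega)
  have h7 := hB.mod_of_mem p hp hr
  have h8 := hB.mod_of_mem q hq (hpq ▸ hr)
  rw [ZMod.val_natCast, ZMod.val_natCast, Nat.mod_eq_of_lt (show p % (M + 2) - M < 2 by omega),
    Nat.mod_eq_of_lt (show q % (M + 2) - M < 2 by omega)] at h4
  omega

/-- If the cycle is a Hamiltonian cycle of length at least three, then no walk is extremal. -/
theorem OptWalk.not_extremal [NeZero g] (hc : ∀ i j, 0 ≤ c i j)
    (hζ : ZeroCycle E c ζ) (h : OptWalk E c ζ w L) (hM : Fintype.card V = g)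
    (hg : 3 ≤ g) : L + 1 ≠ g * g := by
  intro hL
  have hL' : L + 1 = g * g + 0 * (g + 1) := by omega
  have hM' : Fintype.card V = 0 + g := by omega
  have hB := h.blocks hc hζ hM' hL'
  obtain ⟨b₀, h0⟩ := hB.block 0 (by omega)
  obtain ⟨b₁, h1⟩ := hB.block 1 (by omega)
  obtain ⟨b₂, h2⟩ := hB.block 2 (by omega)
  simp only [zero_add, add_zero, zero_mul, one_mul] at h0 h1 h2
  have hgg : 3 * g ≤ g * g := Nat.mul_le_mul_right _ hg
  -- Two visits of one node in one class coincide. Blocks start at multiples of `g`, so different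
  -- blocks start at different nodes.
  have hne : ∀ p q b b', p < q → q ≤ L → (p : ZMod g) = 0 → (q : ZMod g) = 0 → w p = ζ b →
      w q = ζ b' → b ≠ b' := by
    rintro p q b b' hpq hqL hp hq hwp hwq rfl
    have := h.sub_eq_val hc hζ hpq.le hqL hwp hwq (by rw [hp, hq])
    rw [sub_self, ZMod.val_zero] at this
    omega
  have hb01 : b₀ ≠ b₁ := hne 0 g _ _ (by omega) (by omega) (by simp) (by simp)
    (by simpa using h0 0 (by omega)) (by simpa using h1 0 (by omega))
  have hb12 : b₁ ≠ b₂ := hne g (2 * g) _ _ (by omega) (by omega) (by simp) (by simp)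
    (by simpa using h1 0 (by omega)) (by simpa using h2 0 (by omega))
  have hwp := h0 (g - 1) (by omega)
  have hlast : ∀ b : ZMod g, b + ((g - 1 : ℕ) : ZMod g) = b - 1 := fun b => by
    rw [Nat.cast_sub (by omega)]; simp [sub_eq_add_neg]
  rw [hlast] at hwp
  set e := (b₀ - 1 - b₁).val with he
  have helt : e < g := ZMod.val_lt _
  have hwq := h1 e helt
  rw [he, ZMod.natCast_zmod_val, add_sub_cancel, ← he] at hwq
  have heg : e ≠ g - 1 := by
    intro hcon
    apply hb01
    have h3 := congrArg (Nat.cast : ℕ → ZMod g) hcon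
    rw [he, ZMod.natCast_zmod_val, Nat.cast_sub (by omega)] at h3
    simp only [CharP.cast_eq_zero, Nat.cast_one, zero_sub] at h3
    linear_combination h3
  have helt' := ZMod.val_lt (b₀ - 1 - b₂)
  have hwr := h2 _ helt'
  rw [ZMod.natCast_zmod_val, add_sub_cancel] at hwr
  set r := 2 * g + (b₀ - 1 - b₂).val with hr
  -- The last node of block 0 recurs in blocks 1 and 2. Exchanging the two loops moves the passage
  -- from `ζ (b₁ - 1)` to `ζ b₂` inside block 1 of the new walk, since `e < g - 1`. Indices grow by
  -- one there, which forces `b₂ = b₁`.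
  have hB' := (h.loopSwap (p := g - 1) (q := g + e) (r := r) (by omega) (by omega) (by omega)
    (hwp.trans hwq.symm) (hwq.trans hwr.symm)).blocks hc hζ hM' hL'
  obtain ⟨b', h3⟩ := hB'.block 1 (by omega)
  simp only [add_zero, one_mul, zero_add] at h3
  have hsw : ∀ i ≤ r - (g + e), w (MaxPlus.loopSwap (g - 1) (g + e) r (g - 1 + i)) = w (g + e + i) :=
    fun i hi => apply_loopSwap_left (by omega) (by omega) (hwp.trans hwq.symm)
      (hwq.trans hwr.symm) hi
  have h4 := h3 (g - 2 - e) (by omega)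
  have h5 := h3 (g - 1 - e) (by omega)
  rw [show g + (g - 2 - e) = g - 1 + (g - 1 - e) by omega, hsw _ (by omega),
    show g + e + (g - 1 - e) = g + (g - 1) by omega, h1 _ (by omega), hlast] at h4
  rw [show g + (g - 1 - e) = g - 1 + (g - e) by omega, hsw _ (by omega),
    show g + e + (g - e) = 2 * g + 0 by omega, h2 _ (by omega)] at h5
  have h6 := hζ.inj h4
  have h7 := hζ.inj h5
  rw [show g - 1 - e = g - 2 - e + 1 by omega] at h7
  push_cast at h7
  apply hb12
  linear_combination h6 - h7

end Extremal

/-! ### Walks as lists and as functions on positions -/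

section Lists

variable {n : ℕ}

theorem exists_eq_map_range {W : List (Fin n)} (hW : W ≠ []) :
    ∃ w : ℕ → Fin n, W = (List.range (len W + 1)).map w := by
  refine ⟨fun k => W.getD k (W.head hW), List.ext_getElem ?_ fun k h1 h2 => ?_⟩
  · have := List.length_pos_of_ne_nil hW
    simp [len]
    omega
  · simp [List.getElem?_eq_getElem h1]

theorem len_map_range (w : ℕ → Fin n) (k : ℕ) : len ((List.range (k + 1)).map w) = k := by
  simp [len]

theorem isWalk_map_range {E : Fin n → Fin n → Prop} {w : ℕ → Fin n} {k : ℕ} :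
    IsWalk E ((List.range (k + 1)).map w) ↔ ∀ m < k, E (w m) (w (m + 1)) := by
  rw [IsWalk, and_iff_right (by simp), List.isChain_iff_getElem]
  simp

theorem head?_map_range (w : ℕ → Fin n) (k : ℕ) :
    ((List.range (k + 1)).map w).head? = some (w 0) := by
  simp [List.range_succ_eq_map]

theorem getLast?_map_range (w : ℕ → Fin n) (k : ℕ) :
    ((List.range (k + 1)).map w).getLast? = some (w k) := by
  simp [List.range_succ]

theorem tail_map_range (w : ℕ → Fin n) (k : ℕ) :
    ((List.range (k + 1)).map w).tail = (List.range k).map fun m => w (m + 1) := by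
  simp [List.range_succ_eq_map, Function.comp_def]

theorem isCycle_map_range {E : Fin n → Fin n → Prop} {w : ℕ → Fin n} {k : ℕ} :
    IsCycle E ((List.range (k + 1)).map w) ↔ (∀ m < k, E (w m) (w (m + 1))) ∧ 1 ≤ k ∧ w 0 = w k ∧
      ∀ p < k, ∀ q < k, w (p + 1) = w (q + 1) → p = q := by
  rw [IsCycle, isWalk_map_range, len_map_range, head?_map_range, getLast?_map_range, tail_map_range,
    Option.some_inj, List.nodup_map_iff_inj_on List.nodup_range]
  simp only [List.mem_range]

theorem infix_map_range {w : ℕ → Fin n} {k : ℕ} {i j : Fin n} :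
    [i, j] <:+: (List.range (k + 1)).map w ↔ ∃ m < k, w m = i ∧ w (m + 1) = j := by
  rw [List.infix_iff_getElem?]
  constructor
  · rintro ⟨m, hm, h⟩
    simp only [List.length_cons, List.length_nil, List.length_map, List.length_range] at hm h
    have h0 := h 0 (by omega)
    have h1 := h 1 (by omega)
    rw [List.getElem?_eq_getElem (by simp; omega)] at h0 h1
    simp at h0 h1
    exact ⟨m, by omega, h0, by rw [← h1, add_comm]⟩
  · rintro ⟨m, hm, rfl, rfl⟩
    refine ⟨m, by simp; omega, fun i hi => ?_⟩
    simp only [List.length_cons, List.length_nil] at hi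
    rw [List.getElem?_eq_getElem (by simp; omega)]
    interval_cases i <;> simp [add_comm]

theorem weight_map_range (A : MPMat n) (w : ℕ → Fin n) (k : ℕ) :
    weight A ((List.range (k + 1)).map w) = ∑ m ∈ Finset.range k, A (w m) (w (m + 1)) := by
  have h : ((List.range (k + 1)).map w).zip ((List.range (k + 1)).map w).tail =
      (List.range k).map fun m => (w m, w (m + 1)) := by
    refine List.ext_getElem (by simp) fun m h1 h2 => by simp
  rw [weight, h, List.map_map, Finset.sum_range, ← List.sum_ofFn]
  congr 1
  refine List.ext_getElem (by simp) fun m h1 h2 => by simp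

/-! ### The flower -/

theorem flatten_replicate_finRange (hn : 0 < n) (m : ℕ) :
    (List.replicate m (List.finRange n)).flatten =
      (List.range (m * n)).map fun k => ⟨k % n, Nat.mod_lt k hn⟩ := by
  induction m with
  | zero => simp
  | succ m ih =>
    rw [List.replicate_succ', List.flatten_append, ih, Nat.succ_mul, List.range_add, List.map_append]
    congr 1
    refine List.ext_getElem (by simp) fun k h1 h2 => ?_
    simp only [List.length_map, List.length_range] at h2
    simp [Nat.mod_eq_of_lt h2]

theorem flower_eq_map_range [NeZero n] {g M : ℕ} (h : n = M + g) (σ : Equiv.Perm (Fin n)) :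
    flower g σ = (List.range (M + g * n)).map fun k => σ (Fin.ofNat n (k + g)) := by
  rw [flower, flatten_replicate_finRange (Nat.pos_of_ne_zero (NeZero.ne n)), List.range_add, List.map_append, List.map_append]
  congr 1
  · refine List.ext_getElem (by simp; omega) fun k h1 h2 => ?_
    simp only [List.length_map, List.length_range] at h2
    simp only [List.getElem_map, List.getElem_drop, List.getElem_finRange, List.getElem_range]
    congr 1
    ext
    simp [add_comm, Nat.mod_eq_of_lt (show g + k < n by omega)]
  · rw [List.map_map, List.map_map]
    refine List.map_congr_left fun k _ => ?_
    simp only [Function.comp_apply]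
    congr 1
    ext
    simp only [Fin.val_ofNat]
    rw [show M + k + g = k + n by omega, Nat.add_mod_right]

/-- Nodes at positions in different residues modulo `n` differ, so one period of the walk numbers
all nodes. The shift by `M` gives the numbers below `g` to the first block. -/
theorem OptWalk.exists_perm {E : Fin n → Fin n → Prop} {c : Fin n → Fin n → ℝ} {g M L : ℕ}
    [NeZero g] [NeZero n] {ζ : ZMod g → Fin n} {w : ℕ → Fin n} (hc : ∀ i j, 0 ≤ c i j)
    (hζ : ZeroCycle E c ζ) (h : OptWalk E c ζ w L) (hM : n = M + g)
    (hL : L + 1 = g * g + M * (g + 1)) (hg : 2 ≤ g) (hM0 : 0 < M) :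
    ∃ σ : Equiv.Perm (Fin n), (∀ k : Fin n, σ k ∈ Set.range ζ ↔ (k : ℕ) < g) ∧
      ∀ k ≤ L, w k = σ (Fin.ofNat n (k + g)) := by
  have hn : 0 < n := by omega
  have hLn : L + 1 = M + g * n := by rw [hL, hM]; ring
  have hgn : n ≤ g * n := Nat.le_mul_of_pos_left _ (by omega)
  have hcard : Fintype.card (Fin n) = M + g := by rw [Fintype.card_fin, hM]
  have hB := h.blocks hc hζ hcard hL
  have hper := fun {p q : ℕ} => h.mod_eq_of_eq (p := p) (q := q) hc hζ hcard hL hg hM0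
  rw [← hM] at hper
  have hmodL : ∀ x, x % n ≤ L := fun x => by
    have := Nat.mod_lt x hn
    omega
  have hinj : Function.Injective fun k : Fin n => w ((k + M) % n) := by
    intro j k hjk
    have h1 := hper (hmodL _) (hmodL _) hjk
    rw [Nat.mod_mod, Nat.mod_mod] at h1
    have h2 := Nat.ModEq.add_right_cancel' M h1
    exact Fin.ext (h2.eq_of_lt_of_lt j.2 k.2)
  refine ⟨Equiv.ofBijective _ (Finite.injective_iff_bijective.mp hinj), fun k => ?_, ?_⟩
  · simp only [Equiv.ofBijective_apply]
    constructor
    · intro hr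
      have h1 := hB.mod_of_mem _ (hmodL _) hr
      rw [← hM, Nat.mod_mod, Nat.add_mod_eq_ite, Nat.mod_eq_of_lt k.2,
        Nat.mod_eq_of_lt (show M < n by omega)] at h1
      have := k.2
      split_ifs at h1 <;> omega
    · intro hk
      obtain ⟨b, hb⟩ := hB.block 0 (by omega)
      have := hb k hk
      rw [zero_mul, zero_add, add_comm] at this
      rw [Nat.mod_eq_of_lt (by omega), this]
      exact ⟨_, rfl⟩
  · intro k hk
    obtain ⟨j, hj⟩ := (Finite.injective_iff_surjective.mp hinj) (w k)
    have h1 := hper (hmodL _) hk hj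
    simp only at hj
    rw [Nat.mod_mod] at h1
    simp only [Equiv.ofBijective_apply, Fin.val_ofNat]
    rw [← hj]
    congr 1
    rw [Nat.mod_add_mod, h1, show k + g + M = k + n by omega, Nat.add_mod_right]

end Lists

/-! ### Max-plus matrix powers -/

section Matrices

variable {n : ℕ}

theorem le_mul (A B : MPMat n) (i k j : Fin n) : A i k + B k j ≤ mul A B i j :=
  Finset.le_sup (f := fun k => A i k + B k j) (Finset.mem_univ k)

theorem exists_mul_eq (A B : MPMat n) (i j : Fin n) : ∃ k, mul A B i j = A i k + B k j := by
  obtain ⟨k, _, hk⟩ := Finset.exists_mem_eq_sup Finset.univ ⟨i, Finset.mem_univ i⟩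
    fun k => A i k + B k j
  exact ⟨k, hk⟩

theorem mul_assoc' (A B C : MPMat n) : mul (mul A B) C = mul A (mul B C) := by
  funext i j
  apply le_antisymm
  · obtain ⟨k, hk⟩ := exists_mul_eq (mul A B) C i j
    obtain ⟨l, hl⟩ := exists_mul_eq A B i k
    rw [hk, hl, add_assoc]
    exact (add_le_add_right (le_mul B C l k j) _).trans (le_mul A _ i l j)
  · obtain ⟨k, hk⟩ := exists_mul_eq A (mul B C) i j
    obtain ⟨l, hl⟩ := exists_mul_eq B C k j
    rw [hk, hl, ← add_assoc]
    exact (add_le_add_left (le_mul A B i k l) _).trans (le_mul _ C i l j)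

theorem mul_one' (A : MPMat n) : mul A (one n) = A := by
  funext i j
  apply le_antisymm
  · obtain ⟨k, hk⟩ := exists_mul_eq A (one n) i j
    rw [hk, one]
    split_ifs with h
    · rw [h, add_zero]
    · simp
  · have := le_mul A (one n) i j j
    rwa [one, if_pos rfl, add_zero] at this

theorem pow_add (A : MPMat n) (s t : ℕ) : pow A (s + t) = mul (pow A s) (pow A t) := by
  induction t with
  | zero => rw [pow, mul_one', add_zero]
  | succ t ih => rw [← add_assoc, pow, ih, pow, mul_assoc']

theorem pow_mul (A : MPMat n) (s t : ℕ) : pow A (s * t) = pow (pow A s) t := by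
  induction t with
  | zero => rfl
  | succ t ih => rw [Nat.mul_succ, pow_add, ih, pow]

theorem le_pow_add (A : MPMat n) (s t : ℕ) (i k j : Fin n) :
    pow A s i k + pow A t k j ≤ pow A (s + t) i j := by
  rw [pow_add]; exact le_mul _ _ _ _ _

theorem pow_zero_self (A : MPMat n) (i : Fin n) : pow A 0 i i = 0 := if_pos rfl

theorem sum_le_pow (A : MPMat n) (w : ℕ → Fin n) {p q : ℕ} (hpq : p ≤ q) :
    ∑ m ∈ Finset.Ico p q, A (w m) (w (m + 1)) ≤ pow A (q - p) (w p) (w q) := by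
  induction q, hpq using Nat.le_induction with
  | base => simp [pow_zero_self]
  | succ q hpq ih =>
    rw [Finset.sum_Ico_succ_top hpq, Nat.sub_add_comm hpq, pow]
    exact (add_le_add_left ih _).trans (le_mul _ _ _ _ _)

theorem exists_walk_of_pow_ne_bot {A : MPMat n} {t : ℕ} {i j : Fin n} (h : pow A t i j ≠ ⊥) :
    ∃ w : ℕ → Fin n, w 0 = i ∧ w t = j ∧ (∀ m < t, Arc A (w m) (w (m + 1))) ∧
      pow A t i j = ∑ m ∈ Finset.Ico 0 t, A (w m) (w (m + 1)) := by
  induction t generalizing j with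
  | zero =>
    have hij : i = j := by
      by_contra hne
      exact h (if_neg hne)
    subst hij
    exact ⟨fun _ => i, rfl, rfl, by simp, by simp [pow_zero_self]⟩
  | succ t ih =>
    obtain ⟨k, hk⟩ := exists_mul_eq (pow A t) A i j
    have hk' : pow A (t + 1) i j = pow A t i k + A k j := hk
    rw [hk', Ne, WithBot.add_eq_bot, not_or] at h
    obtain ⟨w, h0, ht, harc, hw⟩ := ih h.1
    have hlt : ∀ m ≤ t, Function.update w (t + 1) j m = w m := fun m hm =>
      Function.update_of_ne (by omega) _ _
    refine ⟨Function.update w (t + 1) j, by rw [hlt 0 (by omega), h0], by simp, ?_, ?_⟩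
    · intro m hm
      rcases Nat.lt_succ_iff_lt_or_eq.mp hm with hm | rfl
      · rw [hlt _ hm.le, hlt _ hm]; exact harc m hm
      · rw [hlt _ le_rfl, ht]; simpa [Arc] using h.2
    · rw [hk', Finset.sum_Ico_succ_top (Nat.zero_le t), hlt t le_rfl, ht, hw]
      simp only [Function.update_self]
      congr 1
      refine Finset.sum_congr rfl fun m hm => ?_
      have := (Finset.mem_Ico.mp hm).2
      rw [hlt _ this.le, hlt _ this]

/-- Removing a closed part of weight at most zero from an optimal walk. -/
theorem sum_le_pow_of_eq {A : MPMat n} {w : ℕ → Fin n} {t p q : ℕ} (hpq : p ≤ q) (hq : q ≤ t)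
    (hw : w p = w q) (h0 : pow A (q - p) (w p) (w p) ≤ 0) :
    ∑ m ∈ Finset.Ico 0 t, A (w m) (w (m + 1)) ≤ pow A (p + (t - q)) (w 0) (w t) := by
  rw [← Finset.sum_Ico_consecutive _ (Nat.zero_le p) (hpq.trans hq),
    ← Finset.sum_Ico_consecutive _ hpq hq]
  have h1 := sum_le_pow A w (Nat.zero_le p)
  have h2 := (sum_le_pow A w hpq).trans (le_of_eq_of_le (by rw [← hw]) h0)
  have h3 := sum_le_pow A w hq
  rw [Nat.sub_zero] at h1
  calc _ ≤ pow A p (w 0) (w p) + (0 + pow A (t - q) (w q) (w t)) :=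
        add_le_add h1 (add_le_add h2 h3)
    _ ≤ _ := by rw [zero_add, ← hw]; exact le_pow_add _ _ _ _ _ _

theorem exists_lt_eq_of_le {w : ℕ → Fin n} {t : ℕ} (ht : n ≤ t) :
    ∃ p q, p < q ∧ q ≤ t ∧ w p = w q := by
  obtain ⟨x, y, hxy, h⟩ := Fintype.exists_ne_map_eq_of_card_lt
    (fun k : Fin (t + 1) => w k) (by simp; omega)
  rcases lt_or_gt_of_ne (Fin.val_ne_of_ne hxy) with hlt | hlt
  · exact ⟨x, y, hlt, Nat.le_of_lt_succ y.2, h⟩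
  · exact ⟨y, x, hlt, Nat.le_of_lt_succ x.2, h.symm⟩

/-- If closed walks have weight at most zero, then the Kleene star dominates all powers. -/
theorem pow_le_star {A : MPMat n} (h0 : ∀ k u, pow A k u u ≤ 0) (t : ℕ) (i j : Fin n) :
    pow A t i j ≤ star A i j := by
  induction t using Nat.strong_induction_on with
  | _ t ih =>
    rcases lt_or_ge t n with ht | ht
    · exact Finset.le_sup (f := fun k => pow A k i j) (Finset.mem_range.mpr ht)
    · by_cases hb : pow A t i j = ⊥
      · rw [hb]; exact bot_le
      obtain ⟨w, rfl, rfl, -, hw⟩ := exists_walk_of_pow_ne_bot hb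
      obtain ⟨p, q, hpq, hq, he⟩ := exists_lt_eq_of_le (w := w) ht
      rw [hw]
      exact (sum_le_pow_of_eq hpq.le hq he (h0 _ _)).trans (ih _ (by omega))

theorem IsCycle.exists_map_range {E : Fin n → Fin n → Prop} {Z : List (Fin n)} (hZ : IsCycle E Z) :
    ∃ w : ℕ → Fin n, Z = (List.range (len Z + 1)).map w :=
  exists_eq_map_range hZ.1.1

theorem IsCycle.len_le {E : Fin n → Fin n → Prop} {Z : List (Fin n)} (hZ : IsCycle E Z) :
    len Z ≤ n := by
  have := hZ.2.2.2.length_le_card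
  rwa [Fintype.card_fin, List.length_tail] at this

theorem finite_setOf_isCycle (E : Fin n → Fin n → Prop) : {Z | IsCycle E Z}.Finite := by
  refine (List.finite_length_le (Fin n) (n + 1)).subset fun Z hZ => ?_
  have := IsCycle.len_le hZ
  simp only [len] at this
  show Z.length ≤ n + 1
  omega

theorem cycleMean_le_maxCycleMean {A : MPMat n} {Z : List (Fin n)} (hZ : IsCycle (Arc A) Z) :
    cycleMean A Z ≤ maxCycleMean A := by
  refine le_csSup ?_ ⟨Z, hZ, rfl⟩
  exact ((finite_setOf_isCycle (Arc A)).image (cycleMean A)).bddAbove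

theorem cycleMean_le_zero_iff {A : MPMat n} {Z : List (Fin n)} (hZ : 1 ≤ len Z) :
    cycleMean A Z ≤ 0 ↔ weight A Z ≤ 0 := by
  have hpos : (0 : ℝ) < len Z := by exact_mod_cast hZ
  rw [cycleMean]
  induction weight A Z using WithBot.recBotCoe with
  | bot => simp
  | coe x =>
    rw [WithBot.map_coe, ← WithBot.coe_zero, WithBot.coe_le_coe, WithBot.coe_le_coe,
      div_le_iff₀ hpos, zero_mul]

theorem cycleMean_eq_zero_iff {A : MPMat n} {Z : List (Fin n)} (hZ : 1 ≤ len Z) :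
    cycleMean A Z = 0 ↔ weight A Z = 0 := by
  have hpos : (0 : ℝ) < len Z := by exact_mod_cast hZ
  rw [cycleMean]
  induction weight A Z using WithBot.recBotCoe with
  | bot => simp
  | coe x =>
    rw [WithBot.map_coe, ← WithBot.coe_zero, WithBot.coe_inj, WithBot.coe_inj,
      div_eq_zero_iff, or_iff_left hpos.ne']

/-- A closed walk that is not a cycle splits into two shorter closed walks, to which induction
applies. -/
theorem pow_self_le_zero {A : MPMat n} (hlam : maxCycleMean A = 0) (t : ℕ) (u : Fin n) :
    pow A t u u ≤ 0 := by
  induction t using Nat.strong_induction_on generalizing u with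
  | _ t ih =>
    by_cases hb : pow A t u u = ⊥
    · rw [hb]; exact bot_le
    rcases Nat.eq_zero_or_pos t with rfl | ht
    · exact (pow_zero_self A u).le
    obtain ⟨w, rfl, hwt, harc, hw⟩ := exists_walk_of_pow_ne_bot hb
    by_cases hinj : ∀ p < t, ∀ q < t, w (p + 1) = w (q + 1) → p = q
    · have hZ : IsCycle (Arc A) ((List.range (t + 1)).map w) :=
        isCycle_map_range.mpr ⟨harc, ht, hwt.symm, hinj⟩
      have h1 := cycleMean_le_maxCycleMean hZ
      rw [hlam, cycleMean_le_zero_iff hZ.2.1, weight_map_range] at h1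
      rwa [hw, Nat.Ico_zero_eq_range]
    · have hex : ∃ p q, p < q ∧ q ≤ t ∧ w p = w q ∧ q - p < t := by
        push Not at hinj
        obtain ⟨p, hp, q, hq, he, hne⟩ := hinj
        rcases lt_or_gt_of_ne hne with h | h
        · exact ⟨p + 1, q + 1, by omega, by omega, he, by omega⟩
        · exact ⟨q + 1, p + 1, by omega, by omega, he.symm, by omega⟩
      obtain ⟨p, q, hpq, hq, he, hlt⟩ := hex
      rw [hw]
      have := sum_le_pow_of_eq hpq.le hq he (ih _ hlt _)
      rw [hwt] at this
      exact this.trans (ih _ (by omega) _)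

/-- A potential that makes all arcs have a nonnegative cost. -/
theorem exists_potential {A : MPMat n} (hlam : maxCycleMean A = 0) :
    ∃ (φ : Fin n → ℝ) (c : Fin n → Fin n → ℝ), (∀ i j, 0 ≤ c i j) ∧
      ∀ i j, Arc A i j → A i j = ((φ i - φ j - c i j : ℝ) : Rmax) := by
  have h0 := pow_self_le_zero hlam
  -- `f i` is the largest weight of a walk starting at `i`; it is finite because of the walk of
  -- length zero.
  set f : Fin n → Rmax := fun i => Finset.univ.sup fun j => star A i j with hf
  have hle : ∀ t i j, pow A t i j ≤ f i := fun t i j =>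
    (pow_le_star h0 t i j).trans (Finset.le_sup (f := fun j => star A i j) (Finset.mem_univ j))
  have hfb : ∀ i, f i ≠ ⊥ := fun i hi => by
    have := hle 0 i i
    rw [pow_zero_self, hi, le_bot_iff] at this
    exact WithBot.coe_ne_bot this
  choose φ hφ using fun i => WithBot.ne_bot_iff_exists.mp (hfb i)
  have hstep : ∀ i j, A i j + f j ≤ f i := by
    intro i j
    obtain ⟨k, -, hk⟩ := Finset.exists_mem_eq_sup Finset.univ ⟨i, Finset.mem_univ i⟩
      fun k => star A j k
    have hn : (Finset.range n).Nonempty := ⟨0, Finset.mem_range.mpr (Fin.pos i)⟩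
    obtain ⟨t, -, ht⟩ := Finset.exists_mem_eq_sup (Finset.range n) hn fun t => pow A t j k
    have hfj : f j = pow A t j k := hk.trans ht
    have h1 := le_pow_add A 1 t i j k
    have h2 : A i j ≤ pow A 1 i j := by
      have := le_mul (one n) A i i j
      rwa [one, if_pos rfl, zero_add] at this
    rw [hfj]
    exact (add_le_add_left h2 _).trans (h1.trans (hle _ _ _))
  -- On pairs that are not arcs, the default value makes the cost zero.
  refine ⟨φ, fun i j => φ i - φ j - (A i j).unbotD (φ i - φ j), fun i j => ?_, fun i j hij => ?_⟩
  · have := hstep i j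
    rw [← hφ i, ← hφ j] at this
    revert this
    beta_reduce
    induction A i j using WithBot.recBotCoe with
    | bot => simp
    | coe x =>
      intro this
      rw [← WithBot.coe_add, WithBot.coe_le_coe] at this
      rw [WithBot.unbotD_coe]
      linarith
  · obtain ⟨x, hx⟩ := WithBot.ne_bot_iff_exists.mp hij
    beta_reduce
    rw [← hx, WithBot.unbotD_coe, WithBot.coe_inj]
    ring

/-! ### Powers and walks with costs -/

variable {A : MPMat n} {φ : Fin n → ℝ} {c : Fin n → Fin n → ℝ}

theorem sum_eq_walkCost (hA : ∀ i j, Arc A i j → A i j = ((φ i - φ j - c i j : ℝ) : Rmax))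
    {w : ℕ → Fin n} {t : ℕ} (hw : ∀ m < t, Arc A (w m) (w (m + 1))) :
    ∑ m ∈ Finset.Ico 0 t, A (w m) (w (m + 1)) =
      ((φ (w 0) - φ (w t) - walkCost c w 0 t : ℝ) : Rmax) := by
  induction t with
  | zero => simp [walkCost]
  | succ t ih =>
    rw [Finset.sum_Ico_succ_top (Nat.zero_le t), ih fun m hm => hw m (by omega), walkCost, walkCost,
      Finset.sum_Ico_succ_top (Nat.zero_le t), hA _ _ (hw t (by omega)), ← WithBot.coe_add,
      WithBot.coe_inj]
    ring

theorem CostWalk.le_pow (hA : ∀ i j, Arc A i j → A i j = ((φ i - φ j - c i j : ℝ) : Rmax))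
    {i j : Fin n} {l : ℕ} {x : ℝ} (h : CostWalk (Arc A) c i j l x) :
    ((φ i - φ j - x : ℝ) : Rmax) ≤ pow A l i j := by
  obtain ⟨w, rfl, rfl, hw, rfl⟩ := h.exists_walk
  rw [← sum_eq_walkCost hA hw]
  exact sum_le_pow A w (Nat.zero_le l)

theorem exists_costWalk (hA : ∀ i j, Arc A i j → A i j = ((φ i - φ j - c i j : ℝ) : Rmax))
    {i j : Fin n} {l : ℕ} (h : pow A l i j ≠ ⊥) :
    ∃ x, CostWalk (Arc A) c i j l x ∧ pow A l i j = ((φ i - φ j - x : ℝ) : Rmax) := by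
  obtain ⟨w, rfl, rfl, hw, e⟩ := exists_walk_of_pow_ne_bot h
  refine ⟨walkCost c w 0 l, ?_, ?_⟩
  · simpa using costWalk_segment hw (Nat.zero_le l) le_rfl
  · rw [e, sum_eq_walkCost hA hw]

end Matrices

/-! ### The critical graph -/

section Critical

variable {n : ℕ} {A : MPMat n} {φ : Fin n → ℝ} {c : Fin n → Fin n → ℝ}

theorem CritArc.arc {i j : Fin n} (h : CritArc A i j) : Arc A i j := by
  obtain ⟨Z, hZ, hij⟩ := h
  obtain ⟨w, hw⟩ := hZ.1.exists_map_range
  rw [hw, infix_map_range] at hij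
  obtain ⟨m, hm, rfl, rfl⟩ := hij
  have := hZ.1
  rw [hw, isCycle_map_range] at this
  exact this.1 m hm

theorem isCritCycle_iff (hlam : maxCycleMean A = 0) (hc : ∀ i j, 0 ≤ c i j)
    (hA : ∀ i j, Arc A i j → A i j = ((φ i - φ j - c i j : ℝ) : Rmax)) {w : ℕ → Fin n} {k : ℕ} :
    IsCritCycle A ((List.range (k + 1)).map w) ↔
      IsCycle (Arc A) ((List.range (k + 1)).map w) ∧ ∀ m < k, c (w m) (w (m + 1)) = 0 := by
  refine and_congr_right fun hZ => ?_
  rw [hlam, cycleMean_eq_zero_iff hZ.2.1, weight_map_range, ← Nat.Ico_zero_eq_range,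
    sum_eq_walkCost hA (isCycle_map_range.mp hZ).1, (isCycle_map_range.mp hZ).2.2.1,
    ← WithBot.coe_zero, WithBot.coe_inj, sub_self, zero_sub, neg_eq_zero, walkCost,
    Finset.sum_eq_zero_iff_of_nonneg fun _ _ => hc _ _]
  simp

theorem CritArc.cost_eq_zero (hlam : maxCycleMean A = 0) (hc : ∀ i j, 0 ≤ c i j)
    (hA : ∀ i j, Arc A i j → A i j = ((φ i - φ j - c i j : ℝ) : Rmax)) {i j : Fin n}
    (h : CritArc A i j) : c i j = 0 := by
  obtain ⟨Z, hZ, hij⟩ := h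
  obtain ⟨w, hw⟩ := hZ.1.exists_map_range
  rw [hw, infix_map_range] at hij
  obtain ⟨m, hm, rfl, rfl⟩ := hij
  rw [hw, isCritCycle_iff hlam hc hA] at hZ
  exact hZ.2 m hm

theorem IsCritCycle.isCycle_critArc {Z : List (Fin n)} (hZ : IsCritCycle A Z) :
    IsCycle (CritArc A) Z := by
  obtain ⟨w, hw⟩ := hZ.1.exists_map_range
  have hcyc := hZ.1
  rw [hw, isCycle_map_range] at hcyc ⊢
  refine ⟨fun m hm => ⟨Z, hZ, ?_⟩, hcyc.2⟩
  rw [hw, infix_map_range]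
  exact ⟨m, hm, rfl, rfl⟩

/-- Its arcs may come from different critical cycles, but each has cost zero, and the potential
cancels around a cycle. -/
theorem isCritCycle_of_isCycle (hlam : maxCycleMean A = 0) {Z : List (Fin n)}
    (hZ : IsCycle (CritArc A) Z) : IsCritCycle A Z := by
  obtain ⟨φ, c, hc, hA⟩ := exists_potential hlam
  obtain ⟨w, hw⟩ := hZ.exists_map_range
  rw [hw, isCycle_map_range] at hZ
  rw [hw, isCritCycle_iff hlam hc hA, isCycle_map_range]
  exact ⟨⟨fun m hm => (hZ.1 m hm).arc, hZ.2⟩, fun m hm => (hZ.1 m hm).cost_eq_zero hlam hc hA⟩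

/-- `CritWalk A i j l`: there is a walk of length `l` from `i` to `j` in the critical graph. -/
def CritWalk (A : MPMat n) (i j : Fin n) (l : ℕ) : Prop :=
  ∃ x, CostWalk (CritArc A) (fun _ _ => 0) i j l x

theorem CritWalk.append {i j k : Fin n} {l m : ℕ} (h : CritWalk A i j l) (h' : CritWalk A j k m) :
    CritWalk A i k (l + m) := by
  obtain ⟨x, hx⟩ := h
  obtain ⟨y, hy⟩ := h'
  exact ⟨_, hx.append hy⟩

theorem critWalk_segment {w : ℕ → Fin n} {L p q : ℕ}
    (hw : ∀ k < L, CritArc A (w k) (w (k + 1))) (hpq : p ≤ q) (hq : q ≤ L) :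
    CritWalk A (w p) (w q) (q - p) :=
  ⟨_, costWalk_segment hw hpq hq⟩

theorem CritWalk.exists_walk {i j : Fin n} {l : ℕ} (h : CritWalk A i j l) :
    ∃ w : ℕ → Fin n, w 0 = i ∧ w l = j ∧ ∀ k < l, CritArc A (w k) (w (k + 1)) := by
  obtain ⟨x, hx⟩ := h
  obtain ⟨w, h1, h2, h3, -⟩ := hx.exists_walk
  exact ⟨w, h1, h2, h3⟩

theorem CritWalk.costWalk (hlam : maxCycleMean A = 0) (hc : ∀ i j, 0 ≤ c i j)
    (hA : ∀ i j, Arc A i j → A i j = ((φ i - φ j - c i j : ℝ) : Rmax)) {E : Fin n → Fin n → Prop}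
    (hE : ∀ i j, CritArc A i j → E i j) {i j : Fin n} {l : ℕ}
    (h : CritWalk A i j l) : CostWalk E c i j l 0 := by
  obtain ⟨w, rfl, rfl, hw⟩ := h.exists_walk
  have h1 := costWalk_segment (E := E) (c := c) (fun k hk => hE _ _ (hw k hk)) (Nat.zero_le l) le_rfl
  have h2 : walkCost c w 0 l = 0 := Finset.sum_eq_zero fun k hk =>
    (hw k (Finset.mem_Ico.mp hk).2).cost_eq_zero hlam hc hA
  rwa [h2, Nat.sub_zero] at h1

theorem exists_critWalk_of_reflTransGen {i j : Fin n}
    (h : Relation.ReflTransGen (CritArc A) i j) : ∃ l, CritWalk A i j l := by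
  induction h with
  | refl => exact ⟨0, 0, .nil _⟩
  | tail _ hE ih =>
    obtain ⟨l, x, hx⟩ := ih
    exact ⟨l + 1, _, hx.snoc hE⟩

theorem CritWalk.critNode {i j : Fin n} {l : ℕ} (hi : CritNode A i) (h : CritWalk A i j l) :
    CritNode A j := by
  obtain ⟨x, hx⟩ := h
  cases hx with
  | nil => exact hi
  | snoc _ hE =>
    obtain ⟨Z, hZ, hij⟩ := hE
    exact ⟨Z, hZ, hij.subset (by simp)⟩

/-- A cycle of the critical graph, seen as a closed walk from each of its nodes. -/
theorem critWalk_of_isCycle {Z : List (Fin n)} (hZ : IsCycle (CritArc A) Z) {v : Fin n}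
    (hv : v ∈ Z) : CritWalk A v v (len Z) := by
  obtain ⟨w, hw⟩ := hZ.exists_map_range
  rw [hw] at hv hZ
  rw [isCycle_map_range] at hZ
  obtain ⟨m, hm, rfl⟩ := List.mem_map.mp hv
  rw [List.mem_range] at hm
  have h1 := critWalk_segment hZ.1 (show m ≤ len Z by omega) le_rfl
  have h2 := critWalk_segment hZ.1 (Nat.zero_le m) (by omega)
  rw [← hZ.2.2.1] at h1
  have := h1.append h2
  rwa [show len Z - m + (m - 0) = len Z by omega] at this

/-- Closed walks in the critical graph exist for all large multiples of some `e`, which divides the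
length of every closed walk of the component and the cyclicity of the critical graph. -/
theorem exists_period {i : Fin n} (hi : CritNode A i) : ∃ e N, e ∣ critCyclicity A ∧
    (∀ m, N ≤ m → e ∣ m → CritWalk A i i m) ∧ (∀ l, CritWalk A i i l → e ∣ l) ∧
    ∀ l, IsSCCCycleLength (CritArc A) i l → e ∣ l := by
  set H : AddSubmonoid ℕ :=
    { carrier := {l | CritWalk A i i l}
      zero_mem' := ⟨0, .nil _⟩
      add_mem' := fun h h' => h.append h' } with hH
  -- The closed-walk lengths at `i` form a submonoid of `ℕ`, which contains all large multiples of
  -- its gcd.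
  obtain ⟨N, hN⟩ := Nat.exists_mem_closure_of_ge (H : Set ℕ)
  rw [AddSubmonoid.closure_eq] at hN
  have hdvd : ∀ l, CritWalk A i i l → Nat.setGcd (H : Set ℕ) ∣ l := fun l hl =>
    Nat.setGcd_dvd_of_mem hl
  have hscc : ∀ l, IsSCCCycleLength (CritArc A) i l → Nat.setGcd (H : Set ℕ) ∣ l := by
    rintro l ⟨Z, hZ, rfl, v, hv, h1, h2⟩
    obtain ⟨a, ha⟩ := exists_critWalk_of_reflTransGen h1
    obtain ⟨b, hb⟩ := exists_critWalk_of_reflTransGen h2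
    -- The closed walks through `v` without and with one turn of `Z` differ in length by `len Z`.
    have e1 := hdvd _ (ha.append hb)
    have e2 := hdvd _ ((ha.append (critWalk_of_isCycle hZ hv)).append hb)
    rw [show a + len Z + b = a + b + len Z by ring] at e2
    exact (Nat.dvd_add_right e1).mp e2
  classical
  refine ⟨Nat.setGcd (H : Set ℕ), N, ?_, fun m hm he => hN m hm he, hdvd, hscc⟩
  have h1 : Nat.setGcd (H : Set ℕ) ∣ sccCyclicity (CritArc A) i :=
    Finset.dvd_gcd fun l hl => hscc l (by simpa using (Finset.mem_filter.mp hl).2)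
  exact h1.trans (Finset.dvd_lcm (by simpa using hi))

theorem critCyclicity_pos : 0 < critCyclicity A := by
  rw [Nat.pos_iff_ne_zero, critCyclicity, Ne, Finset.lcm_eq_zero_iff]
  rintro ⟨i, hi, h0⟩
  obtain ⟨Z, hZ, hiZ⟩ : CritNode A i := by simpa using hi
  rw [sccCyclicity, Finset.gcd_eq_zero_iff] at h0
  have hcyc := hZ.isCycle_critArc
  have := h0 (len Z) (by
    simp only [Finset.mem_filter, Finset.mem_Icc]
    exact ⟨⟨hcyc.2.1, hcyc.len_le⟩, Z, hcyc, rfl, i, hiZ, .refl, .refl⟩)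
  have := hcyc.2.1
  simp_all

/-! ### The weak CSR expansion -/

theorem csrM_eq (hlam : maxCycleMean A = 0) : csrM A = star (pow A (critCyclicity A)) := by
  have h1 : inv (0 : Rmax) = 0 := by
    rw [inv, ← WithBot.coe_zero, WithBot.map_coe, neg_zero]
  have h2 : smul (0 : Rmax) A = A := by funext i j; simp [smul]
  rw [csrM, hlam, h1, h2]

theorem pow_le_csrM (hlam : maxCycleMean A = 0) (k : ℕ) (i j : Fin n) :
    pow A (critCyclicity A * k) i j ≤ csrM A i j := by
  rw [csrM_eq hlam, pow_mul]
  refine pow_le_star (fun k u => ?_) k i j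
  rw [← pow_mul]
  exact pow_self_le_zero hlam _ u

theorem exists_csrM_eq (hlam : maxCycleMean A = 0) (i j : Fin n) :
    ∃ k, csrM A i j = pow A (critCyclicity A * k) i j := by
  have hn : (Finset.range n).Nonempty := ⟨0, Finset.mem_range.mpr (Fin.pos i)⟩
  obtain ⟨k, -, hk⟩ := Finset.exists_mem_eq_sup (Finset.range n) hn
    fun t => pow (pow A (critCyclicity A)) t i j
  exact ⟨k, by rw [csrM_eq hlam, pow_mul]; exact hk⟩

theorem arc_csrS {i j : Fin n} : Arc (csrS A) i j ↔ CritArc A i j := by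
  rw [Arc, csrS]
  refine ⟨fun h => ?_, fun h => ?_⟩
  · by_contra hcon
    rw [if_neg hcon] at h
    exact h rfl
  · rw [if_pos h]; exact h.arc

theorem csrS_eq (hA : ∀ i j, Arc A i j → A i j = ((φ i - φ j - c i j : ℝ) : Rmax)) (i j : Fin n)
    (h : Arc (csrS A) i j) : csrS A i j = ((φ i - φ j - c i j : ℝ) : Rmax) := by
  have h' := arc_csrS.mp h
  rw [csrS, if_pos h']
  exact hA i j h'.arc

/-- A walk that avoids critical nodes is counted in `B^t`. Otherwise a free closed walk of the
critical graph is inserted at a critical node, long enough to be cut so that `t` of its arcs serve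
`S^t` and both outer parts have lengths divisible by `γ`, as `C` and `R` require. -/
theorem pow_le_csr_sup (hlam : maxCycleMean A = 0) (t : ℕ) (i j : Fin n) :
    pow A t i j ≤ (csr A t ⊔ pow (nacht A) t) i j := by
  obtain ⟨φ, c, hc, hA⟩ := exists_potential hlam
  by_cases hb : pow A t i j = ⊥
  · rw [hb]; exact bot_le
  obtain ⟨w, rfl, rfl, hw, e⟩ := exists_walk_of_pow_ne_bot hb
  rw [Pi.sup_apply, Pi.sup_apply]
  by_cases hcrit : ∃ k ≤ t, CritNode A (w k)
  swap
  · push Not at hcrit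
    refine le_sup_of_le_right ?_
    have h1 := sum_le_pow (nacht A) w (Nat.zero_le t)
    rw [e]
    refine le_of_eq_of_le (Finset.sum_congr rfl fun m hm => ?_) h1
    have hm := (Finset.mem_Ico.mp hm).2
    rw [nacht, if_neg]
    exact not_or.mpr ⟨hcrit m hm.le, hcrit (m + 1) hm⟩
  · refine le_sup_of_le_left ?_
    obtain ⟨k₀, hk₀, hcrit⟩ := hcrit
    rw [e, sum_eq_walkCost hA hw]
    set γ := critCyclicity A with hγ
    have hγ1 : 0 < γ := critCyclicity_pos
    obtain ⟨d, N, hdγ, hN, -, -⟩ := exists_period hcrit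
    have hle : ∀ x, x ≤ γ * x := fun x => Nat.le_mul_of_pos_left _ hγ1
    have h1 := hle (N + t)
    have h2 := hle t
    -- The first summand pads `k₀` to `γ * (N + t)`, the last pads `t - k₀` to `γ * t`; the total is
    -- a multiple of `γ`, hence of `d`, and at least `N`.
    have hclosed := hN (γ * (N + t) - k₀ + t + (γ * t - (t - k₀))) (by omega) (by
      rw [show γ * (N + t) - k₀ + t + (γ * t - (t - k₀)) = γ * (N + t + t) by
        rw [Nat.mul_add γ (N + t) t]; omega]
      exact hdγ.mul_right _)
    obtain ⟨u, hu0, hu1, hu⟩ := hclosed.exists_walk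
    set s₁ := γ * (N + t) - k₀ with hs₁
    set s₂ := γ * t - (t - k₀) with hs₂
    have w1 := critWalk_segment hu (Nat.zero_le s₁) (by omega)
    have w2 := critWalk_segment hu (show s₁ ≤ s₁ + t by omega) (by omega)
    have w3 := critWalk_segment hu (show s₁ + t ≤ s₁ + t + s₂ by omega) le_rfl
    rw [hu0, Nat.sub_zero] at w1
    rw [hu1, Nat.add_sub_cancel_left] at w3
    rw [Nat.add_sub_cancel_left] at w2
    have c1 := w1.critNode hcrit
    have c2 := w2.critNode c1
    have v1 := (costWalk_segment (c := c) hw (Nat.zero_le k₀) hk₀).append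
      (w1.costWalk hlam hc hA fun _ _ h => h.arc)
    have v2 := w2.costWalk (E := Arc (csrS A)) hlam hc hA fun _ _ h => arc_csrS.mpr h
    have v3 := (w3.costWalk hlam hc hA fun _ _ h => h.arc).append
      (costWalk_segment (c := c) hw hk₀ le_rfl)
    have b1 := v1.le_pow hA
    have b2 := v2.le_pow (csrS_eq hA)
    have b3 := v3.le_pow hA
    rw [show k₀ - 0 + s₁ = γ * (N + t) by omega] at b1
    rw [show s₂ + (t - k₀) = γ * t by omega] at b3
    have b1' := b1.trans (pow_le_csrM hlam _ _ _)
    have b3' := b3.trans (pow_le_csrM hlam _ _ _)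
    have hC : csrC A (w 0) (u s₁) = csrM A (w 0) (u s₁) := if_pos c1
    have hR : csrR A (u (s₁ + t)) (w t) = csrM A (u (s₁ + t)) (w t) := if_pos c2
    have m1 := le_mul (csrC A) (pow (csrS A) t) (w 0) (u s₁) (u (s₁ + t))
    have m2 := le_mul (mul (csrC A) (pow (csrS A) t)) (csrR A) (w 0) (u (s₁ + t)) (w t)
    refine le_trans ?_ m2
    refine le_trans ?_ (add_le_add_left m1 _)
    rw [hC, hR]
    refine le_trans (le_of_eq ?_) (add_le_add (add_le_add b1' b2) b3')
    rw [← WithBot.coe_add, ← WithBot.coe_add, WithBot.coe_inj,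
      ← walkCost_add c w (Nat.zero_le k₀) hk₀]
    ring

/-- The entries of `C S^t R` come from walks through critical nodes. -/
theorem exists_costWalk_of_csr_ne_bot (hlam : maxCycleMean A = 0)
    (hA : ∀ i j, Arc A i j → A i j = ((φ i - φ j - c i j : ℝ) : Rmax))
    {t : ℕ} {i j : Fin n} (h : csr A t i j ≠ ⊥) :
    ∃ k a b x y, CritNode A k ∧ CostWalk (Arc A) c i k a x ∧ CostWalk (Arc A) c k j b y ∧
      a + b ≡ t [MOD critCyclicity A] ∧ csr A t i j = ((φ i - φ j - (x + y) : ℝ) : Rmax) := by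
  obtain ⟨l, hl⟩ := exists_mul_eq (mul (csrC A) (pow (csrS A) t)) (csrR A) i j
  obtain ⟨k, hk⟩ := exists_mul_eq (csrC A) (pow (csrS A) t) i l
  have e : csr A t i j = csrC A i k + pow (csrS A) t k l + csrR A l j := by rw [csr, hl, hk]
  have hb := h
  rw [e, Ne, WithBot.add_eq_bot, WithBot.add_eq_bot, not_or, not_or] at hb
  obtain ⟨⟨hC, hS⟩, hR⟩ := hb
  have hk' : CritNode A k := by
    by_contra hcon
    exact hC (if_neg hcon)
  have hl' : CritNode A l := by
    by_contra hcon
    exact hR (if_neg hcon)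
  have hC' : csrC A i k = csrM A i k := if_pos hk'
  have hR' : csrR A l j = csrM A l j := if_pos hl'
  obtain ⟨α, hα⟩ := exists_csrM_eq hlam i k
  obtain ⟨β, hβ⟩ := exists_csrM_eq hlam l j
  rw [hC', hα] at hC e
  rw [hR', hβ] at hR e
  obtain ⟨x, hx, ex⟩ := exists_costWalk hA hC
  obtain ⟨y, hy, ey⟩ := exists_costWalk (csrS_eq hA) hS
  obtain ⟨z, hz, ez⟩ := exists_costWalk hA hR
  have hy' : CostWalk (Arc A) c k l t y := by
    obtain ⟨w, rfl, rfl, hw, rfl⟩ := hy.exists_walk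
    simpa using costWalk_segment (c := c) (fun m hm => (arc_csrS.mp (hw m hm)).arc)
      (Nat.zero_le t) le_rfl
  refine ⟨k, _, _, x, y + z, hk', hx, hy'.append hz, ?_, ?_⟩
  · rw [show critCyclicity A * α + (t + critCyclicity A * β) = t + critCyclicity A * (α + β) by ring]
    simp [Nat.ModEq]
  · rw [e, ex, ey, ez, ← WithBot.coe_add, ← WithBot.coe_add, WithBot.coe_inj]
    ring

end Critical

section Final

variable {n : ℕ} {A : MPMat n} {φ : Fin n → ℝ} {c : Fin n → Fin n → ℝ}

/-! ### Critical cycles -/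

theorem IsCritCycle.exists_zeroCycle (hlam : maxCycleMean A = 0) (hc : ∀ i j, 0 ≤ c i j)
    (hA : ∀ i j, Arc A i j → A i j = ((φ i - φ j - c i j : ℝ) : Rmax)) {g : ℕ} [NeZero g]
    {Z : List (Fin n)} (hZ : IsCritCycle A Z) (hg : len Z = g) :
    ∃ ζ : ZMod g → Fin n, ZeroCycle (Arc A) c ζ ∧ (∀ a, CritArc A (ζ a) (ζ (a + 1))) ∧
      (∀ v, v ∈ Z ↔ v ∈ Set.range ζ) ∧ Z = (List.range (g + 1)).map fun k : ℕ => ζ k := by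
  obtain ⟨w, hw⟩ := hZ.1.exists_map_range
  rw [hg] at hw
  have hcyc := hZ.isCycle_critArc
  rw [hw, isCycle_map_range] at hcyc
  obtain ⟨harc, hg1, hends, hinj⟩ := hcyc
  have hwk : ∀ k ≤ g, w k = w (k : ZMod g).val := by
    intro k hk
    rw [ZMod.val_natCast]
    rcases hk.lt_or_eq with hk | rfl
    · rw [Nat.mod_eq_of_lt hk]
    · rw [Nat.mod_self, hends]
  have hmap : Z = (List.range (g + 1)).map fun k : ℕ => w (k : ZMod g).val := by
    rw [hw]
    refine List.map_congr_left fun k hk => hwk k ?_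
    rw [List.mem_range] at hk
    omega
  have hstep : ∀ a : ZMod g, w (a + 1).val = w (a.val + 1) := by
    intro a
    have := ZMod.val_lt a
    rw [hwk (a.val + 1) (by omega)]
    push_cast
    rw [ZMod.natCast_zmod_val]
  have hcrit : ∀ a : ZMod g, CritArc A (w a.val) (w (a + 1).val) := fun a => by
    rw [hstep]; exact harc _ (ZMod.val_lt a)
  refine ⟨fun a => w a.val, ⟨?_, fun a => (hcrit a).arc, fun a =>
    (hcrit a).cost_eq_zero hlam hc hA⟩, hcrit, ?_, hmap⟩
  · intro a b hab
    have h1 := hstep (a - 1)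
    have h2 := hstep (b - 1)
    rw [sub_add_cancel] at h1 h2
    have h3 := hinj _ (ZMod.val_lt (a - 1)) _ (ZMod.val_lt (b - 1))
      (h1.symm.trans (Eq.trans hab h2))
    exact sub_left_inj.mp (ZMod.val_injective g h3)
  · intro v
    rw [hw, List.mem_map]
    constructor
    · rintro ⟨k, hk, rfl⟩
      rw [List.mem_range] at hk
      exact ⟨k, (hwk k (by omega)).symm⟩
    · rintro ⟨a, rfl⟩
      have := ZMod.val_lt a
      exact ⟨a.val, List.mem_range.mpr (by omega), rfl⟩

theorem reflTransGen_of_arc {E : Fin n → Fin n → Prop} {g : ℕ} [NeZero g] {ζ : ZMod g → Fin n}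
    (h : ∀ a, E (ζ a) (ζ (a + 1))) (a b : ZMod g) : Relation.ReflTransGen E (ζ a) (ζ b) := by
  have key : ∀ m : ℕ, Relation.ReflTransGen E (ζ a) (ζ (a + m)) := by
    intro m
    induction m with
    | zero => rw [Nat.cast_zero, add_zero]
    | succ m ih => rw [Nat.cast_succ, ← add_assoc]; exact ih.tail (h _)
  have := key (b - a).val
  rwa [ZMod.natCast_zmod_val, add_sub_cancel] at this

/-- A shortest cycle has no chord. -/
theorem eq_add_one_of_arc {E : Fin n → Fin n → Prop} {g : ℕ} [NeZero g] {ζ : ZMod g → Fin n}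
    (hinj : Function.Injective ζ) (h : ∀ a, E (ζ a) (ζ (a + 1)))
    (hmin : ∀ Z, IsCycle E Z → (∃ a, ζ a ∈ Z) → g ≤ len Z) {x y : ZMod g}
    (hxy : E (ζ x) (ζ y)) : y = x + 1 := by
  -- The path along `ζ` from `ζ y` to `ζ x` has length `d`, and the given arc closes it to a cycle
  -- of length `d + 1`. Minimality forces `d = g - 1`.
  set d := (x - y).val with hd
  have hdg : d < g := ZMod.val_lt _
  have hdx : y + (d : ZMod g) = x := by rw [hd, ZMod.natCast_zmod_val, add_sub_cancel]
  set u : ℕ → Fin n := fun m => if m ≤ d then ζ (y + m) else ζ y with hu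
  have hcast : ∀ p q : ℕ, p < g → q < g → (p : ZMod g) = q → p = q := by
    intro p q hp hq e
    rw [ZMod.natCast_eq_natCast_iff'] at e
    rwa [Nat.mod_eq_of_lt hp, Nat.mod_eq_of_lt hq] at e
  have hZ : IsCycle E ((List.range (d + 1 + 1)).map u) := by
    rw [isCycle_map_range]
    refine ⟨fun m hm => ?_, by omega, by simp [hu], fun p hp q hq e => ?_⟩
    · simp only [hu]
      rw [if_pos (by omega)]
      rcases (Nat.lt_succ_iff.mp hm).lt_or_eq with hm | rfl
      · rw [if_pos (by omega), Nat.cast_succ, ← add_assoc]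
        exact h _
      · rw [if_neg (by omega), hdx]
        exact hxy
    · simp only [hu] at e
      split_ifs at e with h1 h2 h2
      · have := hcast _ _ (by omega) (by omega) (add_left_cancel (hinj e))
        omega
      · have := hcast (p + 1) 0 (by omega) (by omega)
          (by rw [Nat.cast_zero]; exact add_eq_left.mp (hinj e))
        omega
      · have := hcast (q + 1) 0 (by omega) (by omega)
          (by rw [Nat.cast_zero]; exact add_eq_left.mp (hinj e).symm)
        omega
      · omega
  have := hmin _ hZ ⟨y, List.mem_map.mpr ⟨0, by simp, by simp [hu]⟩⟩
  rw [len_map_range] at this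
  have hd1 : d + 1 = g := by omega
  have h0 : ((d + 1 : ℕ) : ZMod g) = 0 := by rw [hd1, ZMod.natCast_self]
  rw [Nat.cast_succ] at h0
  rw [← hdx, add_assoc, h0, add_zero]

/-- Without chords, every arc of `ζ'` is a step of `ζ`, so `ζ'` is `ζ` with its index shifted. -/
theorem sameCycle_of_arc {g : ℕ} [NeZero g] {ζ ζ' : ZMod g → Fin n} {E : Fin n → Fin n → Prop}
    (hsub : Set.range ζ' ⊆ Set.range ζ)
    (hchord : ∀ x y, E (ζ x) (ζ y) → y = x + 1) (harc : ∀ a, E (ζ' a) (ζ' (a + 1))) :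
    SameCycle ((List.range (g + 1)).map fun k : ℕ => ζ' k)
      ((List.range (g + 1)).map fun k : ℕ => ζ k) := by
  choose f hf using fun a => hsub ⟨a, rfl⟩
  have hstep : ∀ a, f (a + 1) = f a + 1 := fun a =>
    hchord _ _ (by rw [hf, hf]; exact harc a)
  have hk : ∀ k : ℕ, ζ' k = ζ (f 0 + k) := by
    have : ∀ k : ℕ, f k = f 0 + k := by
      intro k
      induction k with
      | zero => simp
      | succ k ih => rw [Nat.cast_succ, hstep, ih, add_assoc]
    intro k
    rw [← this, hf]
  refine ⟨(-f 0).val, ?_⟩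
  rw [tail_map_range, tail_map_range]
  refine List.ext_getElem (by simp) fun k h1 h2 => ?_
  rw [List.getElem_rotate]
  simp only [List.getElem_map, List.getElem_range, List.length_map, List.length_range]
  rw [hk]
  congr 1
  push_cast
  rw [ZMod.natCast_mod]
  push_cast
  rw [ZMod.natCast_zmod_val]
  ring

/-! ### Optimal walks -/

/-- Rerouting a walk through a critical node so that it visits a given critical node of the same
component, and adjusting its length modulo the length of a cycle of this component. -/
theorem exists_costWalk_through (hlam : maxCycleMean A = 0) (hc : ∀ i j, 0 ≤ c i j)
    (hA : ∀ i j, Arc A i j → A i j = ((φ i - φ j - c i j : ℝ) : Rmax)) {i j k v : Fin n}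
    {a b t g : ℕ} {x y : ℝ} (hk : CritNode A k) (h₁ : CostWalk (Arc A) c i k a x)
    (h₂ : CostWalk (Arc A) c k j b y) (hmod : a + b ≡ t [MOD critCyclicity A])
    (hv : SameSCC (CritArc A) k v) (hg : IsSCCCycleLength (CritArc A) k g) (hg0 : 0 < g) :
    ∃ a' b', CostWalk (Arc A) c i v a' x ∧ CostWalk (Arc A) c v j b' y ∧ a' + b' ≡ t [MOD g] := by
  obtain ⟨e, N, heγ, hN, he, hscc⟩ := exists_period hk
  obtain ⟨p, hp⟩ := exists_critWalk_of_reflTransGen hv.1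
  obtain ⟨q, hq⟩ := exists_critWalk_of_reflTransGen hv.2
  set T := a + b + (p + q) with hT
  have hTle : N + T ≤ g * (N + T) := Nat.le_mul_of_pos_left _ hg0
  have hTt : T ≡ t [MOD e] := by
    have h1 : p + q ≡ 0 [MOD e] := (Nat.modEq_zero_iff_dvd).mpr (he _ (hp.append hq))
    simpa [hT] using (hmod.of_dvd heγ).add h1
  -- A free closed walk of length `m` at `k` extends the detour through `v`, of length `T`, to
  -- length `t + g * (N + T)`. It exists since `m ≥ N` and `e` divides `γ`, `g` and `p + q`.
  set m := t + g * (N + T) - T with hm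
  have hme : e ∣ m := by
    have h1 : m + T ≡ 0 + T [MOD e] := by
      rw [show m + T = t + g * (N + T) by omega, zero_add]
      have h2 : g * (N + T) ≡ 0 [MOD e] :=
        (Nat.modEq_zero_iff_dvd).mpr ((hscc g hg).mul_right _)
      simpa using (hTt.symm.add h2)
    exact (Nat.modEq_zero_iff_dvd).mp (h1.add_right_cancel' _)
  have hclosed := hN m (by omega) hme
  have w1 := h₁.append ((hclosed.append hp).costWalk hlam hc hA fun _ _ h => h.arc)
  have w2 := (hq.costWalk hlam hc hA fun _ _ h => h.arc).append h₂
  rw [add_zero] at w1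
  rw [zero_add] at w2
  refine ⟨_, _, w1, w2, ?_⟩
  rw [show a + (m + p) + (q + b) = t + g * (N + T) by omega]
  simp [Nat.ModEq]

theorem CostWalk.exists_walk_append {V : Type*} {E : V → V → Prop} {c : V → V → ℝ} {i j k : V}
    {l m : ℕ} {x y : ℝ} (h : CostWalk E c i j l x) (h' : CostWalk E c j k m y) :
    ∃ w : ℕ → V, w 0 = i ∧ w l = j ∧ w (l + m) = k ∧ (∀ k < l + m, E (w k) (w (k + 1))) ∧
      walkCost c w 0 (l + m) = x + y := by
  obtain ⟨w, h0, h1, h2, h3⟩ := h.exists_walk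
  obtain ⟨w', h0', h1', h2', h3'⟩ := h'.exists_walk
  set u : ℕ → V := fun p => if p ≤ l then w p else w' (p - l) with hu
  have hul : ∀ p ≤ l, u p = w p := fun p hp => if_pos hp
  have hur : ∀ p, u (l + p) = w' p := by
    intro p
    rcases Nat.eq_zero_or_pos p with rfl | hp
    · rw [add_zero, hul l le_rfl, h1, h0']
    · simp only [hu]
      rw [if_neg (by omega), Nat.add_sub_cancel_left]
  refine ⟨u, by rw [hul 0 (by omega), h0], by rw [hul l le_rfl, h1], by rw [hur, h1'], ?_, ?_⟩
  · intro p hp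
    rcases lt_or_ge p l with hpl | hpl
    · rw [hul p hpl.le, hul (p + 1) hpl]; exact h2 p hpl
    · obtain ⟨p, rfl⟩ := Nat.exists_eq_add_of_le hpl
      rw [add_assoc, hur, hur]; exact h2' p (by omega)
  · rw [← walkCost_add c u (Nat.zero_le l) (by omega), ← h3, ← h3']
    congr 1
    · refine Finset.sum_congr rfl fun p hp => ?_
      have := (Finset.mem_Ico.mp hp).2
      rw [hul p this.le, hul (p + 1) this]
    · rw [walkCost, walkCost, Finset.sum_Ico_eq_sum_range, Nat.Ico_zero_eq_range,
        Nat.add_sub_cancel_left]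
      refine Finset.sum_congr rfl fun p _ => ?_
      rw [add_assoc, hur, hur]

/-- Only the length is minimised, under a bound on the cost; no walk of minimal cost is needed. -/
theorem exists_optWalk {V : Type*} {E : V → V → Prop} {c : V → V → ℝ} {g : ℕ} {ζ : ZMod g → V}
    {i j v : V} {l m : ℕ} {x y : ℝ} (hv : v ∈ Set.range ζ) (h : CostWalk E c i v l x)
    (h' : CostWalk E c v j m y) :
    ∃ w L, OptWalk E c ζ w L ∧ w 0 = i ∧ w L = j ∧ L ≡ l + m [MOD g] ∧
      walkCost c w 0 L ≤ x + y := by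
  classical
  have hex : ∃ L, L ≡ l + m [MOD g] ∧ ∃ a l₁ l₂ x₁ x₂, CostWalk E c i (ζ a) l₁ x₁ ∧
      CostWalk E c (ζ a) j l₂ x₂ ∧ l₁ + l₂ = L ∧ x₁ + x₂ ≤ x + y := by
    obtain ⟨a, rfl⟩ := hv
    exact ⟨l + m, rfl, a, l, m, x, y, h, h', rfl, le_rfl⟩
  obtain ⟨hL, a, l₁, l₂, x₁, x₂, h₁, h₂, hl, hx⟩ := Nat.find_spec hex
  obtain ⟨w, h0, h1, h2, h3, h4⟩ := h₁.exists_walk_append h₂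
  refine ⟨w, l₁ + l₂, ⟨h3, ⟨l₁, by omega, a, h1.symm⟩, ?_⟩, h0, h2, ?_, ?_⟩
  · intro b m₁ m₂ y₁ y₂ e₁ e₂ hmod hy
    rw [h0] at e₁
    rw [h2] at e₂
    rw [hl] at hmod ⊢
    exact Nat.find_min' hex ⟨hmod.trans hL, b, m₁, m₂, y₁, y₂, e₁, e₂, rfl, by linarith⟩
  · rw [hl]; exact hL
  · rw [h4]; exact hx

/-- A walk through a critical cycle that is heavier than all walks of length `t` with the same ends
is longer than `t`. -/
theorem OptWalk.lt_of_pow_lt (hA : ∀ i j, Arc A i j → A i j = ((φ i - φ j - c i j : ℝ) : Rmax))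
    {g : ℕ} {ζ : ZMod g → Fin n} (hζ : ZeroCycle (Arc A) c ζ) {w : ℕ → Fin n} {L t : ℕ}
    (h : OptWalk (Arc A) c ζ w L) (hmod : L ≡ t [MOD g])
    (hlt : pow A t (w 0) (w L) < ((φ (w 0) - φ (w L) - walkCost c w 0 L : ℝ) : Rmax)) :
    t < L := by
  by_contra! hle
  obtain ⟨m, hm⟩ := (Nat.modEq_iff_dvd' hle).mp hmod
  obtain ⟨k, hk, a, ha⟩ := h.touch
  have h1 := costWalk_segment (c := c) h.arc (Nat.zero_le k) hk
  have h2 := costWalk_segment (c := c) h.arc hk le_rfl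
  -- If `L ≤ t`, then `m` free turns of `ζ` would lengthen `w` to a walk of length `t` with the same
  -- cost.
  have h3 := hζ.path a (g * m)
  rw [Nat.cast_mul, ZMod.natCast_self, zero_mul, add_zero, ha] at h3
  have h4 := ((h1.append h3).append h2).le_pow hA
  rw [show k - 0 + g * m + (L - k) = t by omega, add_zero,
    walkCost_add c w (Nat.zero_le k) hk] at h4
  exact absurd hlt (not_lt.mpr h4)

/-- Between fixed ends, weight is a constant minus cost. A competitor of at most the same cost
therefore has maximal weight too, and the minimality of the length applies to it. -/
theorem IsTwiceOptimal.exists_optWalk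
    (hA : ∀ i j, Arc A i j → A i j = ((φ i - φ j - c i j : ℝ) : Rmax)) {g : ℕ}
    {ζ : ZMod g → Fin n} {Z W : List (Fin n)} (hZ : ∀ v, v ∈ Z ↔ v ∈ Set.range ζ)
    (hW : IsTwiceOptimal A g Z W) :
    ∃ w : ℕ → Fin n, W = (List.range (len W + 1)).map w ∧ OptWalk (Arc A) c ζ w (len W) := by
  obtain ⟨i, j, hmem, hmax, hmin⟩ := hW
  obtain ⟨w, hw⟩ := exists_eq_map_range hmem.1.1
  refine ⟨w, hw, ?_⟩
  set L := len W
  obtain ⟨hwalk, hi, hj, -, v, hv, hvZ⟩ := hmem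
  rw [hw] at hwalk hi hj hv
  rw [isWalk_map_range] at hwalk
  rw [head?_map_range, Option.some_inj] at hi
  rw [getLast?_map_range, Option.some_inj] at hj
  obtain ⟨k, hk, rfl⟩ := List.mem_map.mp hv
  rw [List.mem_range] at hk
  refine ⟨hwalk, ⟨k, by omega, (hZ _).mp hvZ⟩, ?_⟩
  intro a l₁ l₂ x₁ x₂ h₁ h₂ hmod hx
  obtain ⟨u, h0, h1, h2, h3, h4⟩ := h₁.exists_walk_append h₂
  set U := (List.range (l₁ + l₂ + 1)).map u with hU
  have hlen : len U = l₁ + l₂ := len_map_range _ _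
  have hmemU : U ∈ walksThrough A i j L g Z := by
    refine ⟨isWalk_map_range.mpr h3, ?_, ?_, ?_, ζ a, ?_, (hZ _).mpr ⟨a, rfl⟩⟩
    · rw [hU, head?_map_range, h0, hi]
    · rw [hU, getLast?_map_range, h2, hj]
    · rw [hlen]; exact hmod
    · exact List.mem_map.mpr ⟨l₁, List.mem_range.mpr (by omega), h1⟩
  have hle : weight A W ≤ weight A U := by
    rw [hw, hU, weight_map_range, weight_map_range, ← Nat.Ico_zero_eq_range,
      ← Nat.Ico_zero_eq_range, sum_eq_walkCost hA hwalk, sum_eq_walkCost hA h3, h0, h2, h4,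
      WithBot.coe_le_coe]
    linarith
  have := hmin U hmemU (le_antisymm (hmax U hmemU) hle)
  rwa [hlen] at this

/-! ### The weak CSR threshold -/

theorem pow_nacht_le (A : MPMat n) (t : ℕ) (i j : Fin n) : pow (nacht A) t i j ≤ pow A t i j := by
  by_cases hb : pow (nacht A) t i j = ⊥
  · rw [hb]; exact bot_le
  obtain ⟨w, rfl, rfl, hw, e⟩ := exists_walk_of_pow_ne_bot hb
  rw [e]
  refine le_of_eq_of_le (Finset.sum_congr rfl fun m hm => ?_) (sum_le_pow A w (Nat.zero_le t))
  have := hw m (Finset.mem_Ico.mp hm).2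
  rw [Arc, nacht] at this
  rw [nacht, if_neg]
  intro hcon
  exact this (if_pos hcon)

/-- Just below a positive weak CSR threshold, some entry of `C S^t R` exceeds that of `A^t`. -/
theorem exists_pow_lt_csr (hlam : maxCycleMean A = 0) {t : ℕ} (ht : T1 A = t + 1) :
    ∃ i j, pow A t i j < csr A t i j := by
  -- As `sInf ∅ = 0`, a positive threshold is really attained.
  have hne : {T | ∀ t, T ≤ t → pow A t = csr A t ⊔ pow (nacht A) t}.Nonempty :=
    Nat.nonempty_of_sInf_eq_succ ht
  have hmem := Nat.sInf_mem hne
  have hnot : t ∉ {T | ∀ t, T ≤ t → pow A t = csr A t ⊔ pow (nacht A) t} :=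
    Nat.notMem_of_lt_sInf (show t < T1 A by omega)
  change ∀ s, T1 A ≤ s → _ at hmem
  by_contra! hcon
  refine hnot fun s hs => ?_
  rcases hs.lt_or_eq with hs | rfl
  · exact hmem s (by omega)
  · funext i j
    refine le_antisymm (pow_le_csr_sup hlam t i j) ?_
    exact sup_le (hcon i j) (pow_nacht_le A t i j)

theorem CritNode.exists_isSCCCycleLength {k : Fin n} (hk : CritNode A k) :
    IsSCCCycleLength (CritArc A) k (sccGirth (CritArc A) k) := by
  obtain ⟨Z, hZ, hkZ⟩ := hk
  exact Nat.sInf_mem (s := {l | IsSCCCycleLength (CritArc A) k l})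
    ⟨len Z, Z, hZ.isCycle_critArc, rfl, k, hkZ, .refl, .refl⟩

theorem CritNode.sccGirth_le {k : Fin n} (hk : CritNode A k) :
    sccGirth (CritArc A) k ≤ critGirth A := by
  classical
  exact Finset.le_sup (f := sccGirth (CritArc A)) (by simpa using hk)

theorem CritWalk.repeat {v : Fin n} {l : ℕ} (h : CritWalk A v v l) (m : ℕ) :
    CritWalk A v v (l * m) := by
  induction m with
  | zero => exact ⟨0, .nil _⟩
  | succ m ih => exact ih.append h

end Final

section Uniqueness

variable {n : ℕ} {A : MPMat n} {φ : Fin n → ℝ} {c : Fin n → Fin n → ℝ}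

/-- If `T₁(A) = DM(g, n)`, then there are a critical cycle of length `g`, shortest in its component,
and an extremal walk through it that is heavier than all walks of length `DM(g, n) - 1`. -/
theorem exists_extremal_walk (hlam : maxCycleMean A = 0) (hc : ∀ i j, 0 ≤ c i j)
    (hA : ∀ i j, Arc A i j → A i j = ((φ i - φ j - c i j : ℝ) : Rmax)) {g t M : ℕ} [NeZero g]
    (hgirth : critGirth A = g) (hM : n = M + g) (hn : 3 ≤ n) (ht : t + 1 = g * (n - 2) + n)
    (hT : T1 A = t + 1) :
    ∃ (Z : List (Fin n)) (ζ : ZMod g → Fin n) (w : ℕ → Fin n) (L : ℕ), IsCritCycle A Z ∧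
      len Z = g ∧ ZeroCycle (Arc A) c ζ ∧ (∀ a, CritArc A (ζ a) (ζ (a + 1))) ∧
      (∀ v, v ∈ Z ↔ v ∈ Set.range ζ) ∧ (Z = (List.range (g + 1)).map fun k : ℕ => ζ k) ∧
      (∀ x y, CritArc A (ζ x) (ζ y) → y = x + 1) ∧ OptWalk (Arc A) c ζ w L ∧
      L + 1 = g * g + M * (g + 1) ∧
      pow A t (w 0) (w L) < ((φ (w 0) - φ (w L) - walkCost c w 0 L : ℝ) : Rmax) := by
  obtain ⟨i, j, hlt⟩ := exists_pow_lt_csr hlam hT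
  obtain ⟨k, a, b, x, y, hk, h₁, h₂, hmod, e⟩ :=
    exists_costWalk_of_csr_ne_bot hlam hA (ne_bot_of_gt hlt)
  obtain ⟨Z, hZ, hlen, v, hvZ, hkv⟩ := hk.exists_isSCCCycleLength
  have hgg := hk.sccGirth_le
  rw [hgirth] at hgg
  -- The component met by the walk has a girth `g' ≤ g`; equality comes from the length estimates
  -- below.
  set g' := sccGirth (CritArc A) k with hg'
  have hg1 : 1 ≤ g' := hlen ▸ hZ.2.1
  have : NeZero g' := ⟨by omega⟩
  obtain ⟨a', b', h₁', h₂', hmod'⟩ := exists_costWalk_through hlam hc hA hk h₁ h₂ hmod hkv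
    hk.exists_isSCCCycleLength hg1
  have hcrit := isCritCycle_of_isCycle hlam hZ
  obtain ⟨ζ, hζ, harc, hmem, hmap⟩ := hcrit.exists_zeroCycle hlam hc hA hlen
  obtain ⟨w, L, hopt, rfl, rfl, hL, hcost⟩ := exists_optWalk ((hmem v).mp hvZ) h₁' h₂'
  have hlt' : pow A t (w 0) (w L) < ((φ (w 0) - φ (w L) - walkCost c w 0 L : ℝ) : Rmax) := by
    refine hlt.trans_le ?_
    rw [e, WithBot.coe_le_coe]
    linarith
  have htL := hopt.lt_of_pow_lt hA hζ (hL.trans hmod') hlt'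
  have hgap : t + g' ≤ L := by
    have := Nat.le_of_dvd (by omega) ((Nat.modEq_iff_dvd' htL.le).mp (hL.trans hmod').symm)
    omega
  obtain ⟨M', hM'⟩ := Nat.exists_eq_add_of_le' (show g' ≤ n by omega)
  have hup := hopt.length_le hc hζ (M := M') (by rw [Fintype.card_fin, hM'])
  -- The bounds `t + g' ≤ L` and `length_le` combine to `g * (n - 2) ≤ g' * (n - 2)`, with `n ≥ 3`.
  have hgeq : g' = g := by
    refine le_antisymm hgg ?_
    obtain ⟨r, rfl⟩ := Nat.exists_eq_add_of_le' hn
    have h1 : g' * g' + M' * (g' + 1) + g' = g' * (r + 3) + (r + 3) := by rw [hM']; ring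
    have h2 : t + 1 = g * (r + 1) + (r + 3) := ht
    have h3 : g * (r + 1) ≤ g' * (r + 1) := by
      have : g' * (r + 3) = g' * (r + 1) + 2 * g' := by ring
      omega
    exact Nat.le_of_mul_le_mul_right h3 (by omega)
  clear_value g'
  subst hgeq
  obtain rfl : M' = M := by omega
  refine ⟨Z, ζ, w, L, hcrit, hlen, hζ, harc, hmem, hmap, ?_, hopt, ?_, hlt'⟩
  · intro x y hxy
    refine eq_add_one_of_arc hζ.inj harc (fun Z' hZ' ⟨a₀, ha₀⟩ => ?_) hxy
    rw [hg']
    refine Nat.sInf_le ⟨Z', hZ', rfl, ζ a₀, ha₀, ?_⟩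
    obtain ⟨a₁, rfl⟩ := (hmem v).mp hvZ
    exact ⟨hkv.1.trans (reflTransGen_of_arc harc _ _), (reflTransGen_of_arc harc _ _).trans hkv.2⟩
  · refine le_antisymm hup ?_
    obtain ⟨r, rfl⟩ := Nat.exists_eq_add_of_le' hn
    have h1 : g' * g' + M' * (g' + 1) + g' = g' * (r + 3) + (r + 3) := by rw [hM']; ring
    have h2 : t + 1 = g' * (r + 1) + (r + 3) := ht
    have : g' * (r + 3) = g' * (r + 1) + 2 * g' := by ring
    omega

/-! ### Uniqueness of the critical cycle of length `g` -/

/-- An extremal walk that is heavier than all walks of length `DM(g, n) - 1` meets critical cycles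
of length `g` only in nodes of `ζ`. -/
theorem OptWalk.mem_range_of_isCritCycle (hlam : maxCycleMean A = 0) (hc : ∀ i j, 0 ≤ c i j)
    (hA : ∀ i j, Arc A i j → A i j = ((φ i - φ j - c i j : ℝ) : Rmax)) {g t M L : ℕ} [NeZero g]
    {ζ : ZMod g → Fin n} {w : ℕ → Fin n} (hζ : ZeroCycle (Arc A) c ζ)
    (h : OptWalk (Arc A) c ζ w L) (hM : n = M + g) (hL : L + 1 = g * g + M * (g + 1)) (hg : 2 ≤ g)
    (hM0 : 0 < M) (ht : t + 1 = g * (n - 2) + n)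
    (hlt : pow A t (w 0) (w L) < ((φ (w 0) - φ (w L) - walkCost c w 0 L : ℝ) : Rmax))
    {Z : List (Fin n)} (hZ : IsCritCycle A Z) (hlen : len Z = g) {v : Fin n} (hv : v ∈ Z) :
    v ∈ Set.range ζ := by
  have : NeZero n := ⟨by omega⟩
  obtain ⟨σ, hσ, hw⟩ := h.exists_perm hc hζ hM hL hg hM0
  have hLn : L + 1 = M + g * n := by rw [hL, hM]; ring
  obtain ⟨κ, rfl⟩ := σ.surjective v
  rw [hσ]
  by_contra! hκ
  have hκn := κ.2
  have hgn : n ≤ g * n := Nat.le_mul_of_pos_left _ (by omega)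
  -- The walk starts with the nodes numbered `g, …, n - 1`, so `v` is met at a position `p < M`.
  set p := (κ : ℕ) - g with hp
  have hwp : w p = σ κ := by
    rw [hw p (by omega), show p + g = κ by omega]
    congr 1
    ext
    simp
  -- Both are the node numbered `n - 1`, so the initial segment alone already leads to the end of
  -- the walk.
  have hwL : w (M - 1) = w L := by
    rw [hw _ (by omega), hw L le_rfl, show L + g = M - 1 + g + g * n by omega]
    congr 1
    ext
    simp
  have w1 := costWalk_segment (c := c) h.arc (Nat.zero_le p) (by omega)
  have w2 := costWalk_segment (c := c) h.arc (show p ≤ M - 1 by omega) (by omega)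
  have w3 := ((critWalk_of_isCycle hZ.isCycle_critArc hv).repeat (n - 1)).costWalk hlam hc hA
    fun _ _ h => h.arc
  rw [hwp] at w1
  rw [hwp, hwL] at w2
  have h4 := ((w1.append w3).append w2).le_pow hA
  -- The initial segment with `n - 1` turns of `Z` has length `M - 1 + g * (n - 1)`, which is
  -- exactly `t`.
  have hlen' : p - 0 + len Z * (n - 1) + (M - 1 - p) = t := by
    rw [hlen]
    obtain ⟨r, rfl⟩ := Nat.exists_eq_add_of_le' (show 2 ≤ n by omega)
    rw [show r + 2 - 1 = r + 1 by omega, Nat.mul_succ]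
    rw [Nat.add_sub_cancel] at ht
    omega
  rw [hlen'] at h4
  have h5 := h4.trans_lt hlt
  rw [WithBot.coe_lt_coe] at h5
  have e1 := walkCost_add c w (Nat.zero_le p) (show p ≤ M - 1 by omega)
  have e2 := walkCost_add c w (Nat.zero_le (M - 1)) (show M - 1 ≤ L by omega)
  have e3 := walkCost_nonneg hc w (M - 1) L
  linarith

end Uniqueness

end MaxPlus

theorem propositionp {n : ℕ} (A : MPMat n) (g : ℕ)
    (hlam : MaxPlus.maxCycleMean A = 0)
    (hgirth : MaxPlus.critGirth A = g)
    (hg : 2 ≤ g)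
    (hT : (MaxPlus.T1 A : ℤ) = MaxPlus.DM g n)
    (hne : ¬ (n = 2 ∧ g = 2)) :
    ∃ Z₀ : List (Fin n),
      (MaxPlus.IsCritCycle A Z₀ ∧ MaxPlus.len Z₀ = g) ∧
      (∀ Z : List (Fin n), MaxPlus.IsCritCycle A Z → MaxPlus.len Z = g →
        MaxPlus.SameCycle Z Z₀) ∧
      ∀ W₀ : List (Fin n), MaxPlus.IsInteresting A g Z₀ W₀ →
        ∃ σ : Equiv.Perm (Fin n),
          (∀ k : Fin n, σ k ∈ Z₀ ↔ (k : ℕ) < g) ∧ W₀ = MaxPlus.flower g σ := by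
  open MaxPlus in
  have : NeZero g := ⟨by omega⟩
  obtain ⟨φ, c, hc, hA⟩ := exists_potential hlam
  have hgn : g ≤ n := by
    rw [← hgirth, critGirth]
    refine Finset.sup_le fun i hi => ?_
    obtain ⟨Z, hZ, hlen, -⟩ :=
      CritNode.exists_isSCCCycleLength (A := A) (k := i) (by simpa using hi)
    rw [← hlen]
    exact hZ.len_le
  -- The value `n = 2` would force `g = 2`, the excluded case.
  have hn : 3 ≤ n := by omega
  obtain ⟨M, hM⟩ := Nat.exists_eq_add_of_le' hgn
  obtain ⟨t, ht⟩ : ∃ t, t + 1 = g * (n - 2) + n :=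
    ⟨g * (n - 2) + n - 1, by omega⟩
  have hDM : DM g n = ((g * (n - 2) + n : ℕ) : ℤ) := by
    rw [DM]
    push_cast [show 2 ≤ n by omega]
    ring
  rw [hDM, Nat.cast_inj, ← ht] at hT
  obtain ⟨Z, ζ, w, L, hcrit, hlen, hζ, harc, hmem, hmap, hchord, hopt, hL, hlt⟩ :=
    exists_extremal_walk hlam hc hA hgirth hM hn ht hT
  have hcard : Fintype.card (Fin n) = M + g := by rw [Fintype.card_fin, hM]
  have hM0 : 0 < M := by
    by_contra hcon
    obtain rfl : M = 0 := by omega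
    -- Here the cycle is Hamiltonian and `g = n ≥ 3`.
    exact hopt.not_extremal hc hζ (by omega) (by omega) (by omega)
  have : NeZero n := ⟨by omega⟩
  refine ⟨Z, ⟨hcrit, hlen⟩, fun Z' hZ' hlen' => ?_, fun W hW => ?_⟩
  · obtain ⟨ζ', -, harc', hmem', hmap'⟩ := hZ'.exists_zeroCycle hlam hc hA hlen'
    rw [hmap, hmap']
    refine sameCycle_of_arc (fun v hv => ?_) hchord harc'
    exact hopt.mem_range_of_isCritCycle hlam hc hA hζ hM hL hg hM0 ht hlt hZ' hlen' ((hmem' v).mpr hv)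
  · obtain ⟨u, hu, hopt'⟩ := hW.1.exists_optWalk hA hmem
    have hlenW : len W + 1 = g * g + M * (g + 1) := by
      have h1 := hW.2
      rw [hDM, ← ht] at h1
      have h2 : t + 1 + g = len W + 1 := by omega
      rw [← h2, ht]
      obtain ⟨r, rfl⟩ := Nat.exists_eq_add_of_le' (show 2 ≤ n by omega)
      rw [Nat.add_sub_cancel]
      have h3 : g * g + M * (g + 1) + g = g * (r + 2) + (r + 2) := by rw [hM]; ring
      have h4 : g * (r + 2) = g * r + 2 * g := by ring
      omega
    obtain ⟨σ, hσ, hσw⟩ := hopt'.exists_perm hc hζ hM hlenW hg hM0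
    refine ⟨σ, fun k => (hmem _).trans (hσ k), ?_⟩
    rw [hu, flower_eq_map_range hM, show M + g * n = len W + 1 by rw [hlenW, hM]; ring]
    refine List.map_congr_left fun k hk => hσw k ?_
    rw [List.mem_range] at hk
    omega
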